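/- Let $d\ge 1$, let $\mathbb H$ be a separable complex Hilbert space with inner product $\langle\cdot,\cdot\rangle$ and a designated ("real") complete orthonormal system $\{e_j\}$, put $\overline{x}=\sum_j\overline{\langle x,e_j\rangle}\,e_j$ (so $x$ is real if $\overline x=x$), $(x\otimes y)(z)=\langle z,y\rangle x$, and write $\|\cdot\|_{\rm tr}$, $\|\cdot\|_{\rm HS}$, $\langle\cdot,\cdot\rangle_{\rm HS}$ for the trace norm, Hilbert–Schmidt norm and Hilbert–Schmidt inner product of operators on $\mathbb H$. **Process.** Call a process $X=\{X(t),t\in\mathbb Z^d\}$ with values in $\mathbb H$ *admissible* if it is real, has mean zero, is second-order stationary (finite second moments; $\mathbb E[X(t)\otimes X(s)]$ and $\mathbb E[X(t)\otimes\overline{X(s)}]$ depend on $t-s$ only), its covariance $C(h)=\mathbb E[X(h)\otimes X(0)]$ satisfies $\sum_{k}\|C(k)\|_{\rm tr}<\infty$, $\mathbb E\|X(t)\|^4<\infty$ for all $t$, and the fourth-order cumulants $$\begin{aligned}{\rm cum}(Y_1,Y_2,Y_3,Y_4)={}&\mathbb E\langle Y_1\otimes Y_2,Y_3\otimes Y_4\rangle_{\rm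 HS}-\langle\mathbb E(Y_1\otimes Y_2),\mathbb E(Y_3\otimes Y_4)\rangle_{\rm HS}\\&-\mathbb E\langle Y_1,Y_3\rangle\,\mathbb E\langle Y_4,Y_2\rangle-\langle\mathbb E(Y_1\otimes\overline{Y_4}),\mathbb E(Y_3\otimes\overline{Y_2})\rangle_{\rm HS}\end{aligned}$$ are shift invariant, ${\rm cum}(X(t+\tau),X(s+\tau),X(w+\tau),X(v+\tau))={\rm cum}(X(t),X(s),X(w),X(v))$, with $$\kappa(X):=\sup_{w\in\mathbb Z^d}\sum_{u\in\mathbb Z^d}\sum_{v\in\mathbb Z^d}|{\rm cum}(X(u),X(v),X(w),X(0))|<\infty .$$ Its spectral density is $f(\theta)=(2\pi)^{-d}\sum_{k\in\mathbb Z^d}e^{\mathbf i k^\top\theta}C(k)$. For $\beta,L>0$ let $$\mathcal P_D(\beta,L)=\Big\{f(\theta)=(2\pi)^{-d}\sum_{k\in\mathbb Z^d}C(k)e^{\mathbf i\theta^\top k}:\ \sum_{k\in\mathbb Z^d}\|C(k)\|_{\rm tr}(1+\|k\|_2^\beta)\le L\Big\}.$$ **Kernel.** Let $K:\mathbb R^d\to[0,\infty)$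 be continuous, with $S_K=\{K>0\}$ bounded, $\sup K=K(0)=1$, and differentiable with bounded gradient in a neighbourhood of $0$. Suppose that for some integer $\lambda>\max(0,\beta-1)$ all partial derivatives of $K$ up to order $\lambda+1$ exist on $\mathbb R^d$, $\partial^{\alpha}K(0)=0$ for $1\le|\alpha|\le\lambda$, and $\sup_h|\partial^\alpha K(h)|<\infty$ for $|\alpha|=\lambda+1$. **Sampling and estimator.** Let $\mathbb T_n=\prod_{\ell=1}^d\{1,\dots,n_\ell\}$ with $n_\ell\to\infty$ for every $\ell$ as $n\to\infty$, let $|\mathbb T_n|=\prod_\ell n_\ell$ be its cardinality, $T_n=\prod_\ell[0,n_\ell]$, and let $\Delta_n>0$ be such that $(\Delta_nS_K)\cap\mathbb Z^d\subset\mathbb T_n-\mathbb T_n$ for all $n$ and $\Delta_n^d/|\mathbb T_n|\to0$. With $|\cdot|$ in the denominator denoting Lebesgue measure, let $$\hat f_n(\theta)=\frac1{(2\pi)^d}\sum_{t\in\mathbb T_n}\sum_{s\in\mathbb T_n}e^{\mathbf i(t-s)^\top\theta}\,\frac{X(t)\otimes X(s)}{|T_n\cap(T_n-(t-s))|}\,K\Big(\frac{t-s}{\Delta_n}\Big).$$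 **Claim.** (i) Uniformly over all admissible processes $X$ (on any probability space) whose spectral density $f$ lies in $\mathcal P_D(\beta,L)$, $$\sup_{f\in\mathcal P_D(\beta,L)}\ \sup_{\theta\in[-\pi,\pi]^d}\big\|\mathbb E\hat f_n(\theta)-f(\theta)\big\|_{\rm HS}=\mathcal O(\Delta_n^{-\beta}),\qquad n\to\infty .$$ (ii) If moreover $\Delta_n=|\mathbb T_n|^{1/(2\beta+d)}$ for all $n$, then for every $M<\infty$, uniformly over all admissible processes $X$ (on any probability space) with $\kappa(X)\le M$ whose spectral density $f$ lies in $\mathcal P_D(\beta,L)$, $$\sup_{f\in\mathcal P_D(\beta,L)}\ \sup_{\theta\in[-\pi,\pi]^d}\Big(\mathbb E\big\|\hat f_n(\theta)-f(\theta)\big\|_{\rm HS}^2\Big)^{1/2}=\mathcal O\big(|\mathbb T_n|^{-\beta/(2\beta+d)}\big),\qquad n\to\infty .$$ -/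

import Mathlib

open MeasureTheory Filter Topology
open scoped ENNReal NNReal Pointwise

noncomputable section

namespace SpectralDensity

/-! ### Operators on a Hilbert space -/

section Operators

variable {H : Type*} [NormedAddCommGroup H] [InnerProductSpace ℂ H] [CompleteSpace H]
variable {ι : Type*}

/-- The trace norm `‖T‖_tr = ∑ j, ⟨(T* T)^{1/2} e_j, e_j⟩ ∈ [0, ∞]`. -/
def traceNorm (e : HilbertBasis ι ℂ H) (T : H →L[ℂ] H) : ℝ≥0∞ :=
  ∑' j, ENNReal.ofReal (RCLike.re (inner ℂ (CFC.abs T (e j)) (e j)))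

/-- The Hilbert-Schmidt norm `‖T‖_HS = (∑ j, ‖T e_j‖²)^{1/2} = (trace (T* T))^{1/2} ∈ [0, ∞]`. -/
def hsNorm (e : HilbertBasis ι ℂ H) (T : H →L[ℂ] H) : ℝ≥0∞ :=
  (∑' j, ‖T (e j)‖ₑ ^ 2) ^ (1 / 2 : ℝ)

/-- The Hilbert-Schmidt inner product `⟨A, B⟩_HS = trace (A* B) = ∑ j, ⟨A e_j, B e_j⟩`
(inner products are conjugate-linear in the first variable). -/
def hsInner (e : HilbertBasis ι ℂ H) (A B : H →L[ℂ] H) : ℂ :=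
  ∑' j, inner ℂ (A (e j)) (B (e j))

/-- Complex conjugation with respect to the designated real orthonormal basis. -/
def conjVec (e : HilbertBasis ι ℂ H) (x : H) : H :=
  ∑' j, (starRingEnd ℂ) (inner ℂ (e j) x) • e j

end Operators

/-! ### Second-order structure of a random field -/

section RandomField

variable {H : Type*} [NormedAddCommGroup H] [InnerProductSpace ℂ H] [CompleteSpace H]
variable {ι : Type*} {Ω : Type*} [MeasurableSpace Ω] {d : ℕ}

/-- The cross-covariance operator `E[Y ⊗ Z]` of centred random vectors, where
`(y ⊗ z)(x) = ⟨x, z⟩ y`. -/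
def covOp (P : Measure Ω) (Y Z : Ω → H) : H →L[ℂ] H :=
  ∫ ω, InnerProductSpace.rankOne ℂ (Y ω) (Z ω) ∂P

/-- The fourth-order cumulant of centred random vectors in `H`. -/
def cum4 (e : HilbertBasis ι ℂ H) (P : Measure Ω) (Y₁ Y₂ Y₃ Y₄ : Ω → H) : ℂ :=
  (∫ ω, hsInner e (InnerProductSpace.rankOne ℂ (Y₁ ω) (Y₂ ω))
      (InnerProductSpace.rankOne ℂ (Y₃ ω) (Y₄ ω)) ∂P)
    - hsInner e (covOp P Y₁ Y₂) (covOp P Y₃ Y₄)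
    - (∫ ω, inner ℂ (Y₁ ω) (Y₃ ω) ∂P) * (∫ ω, inner ℂ (Y₄ ω) (Y₂ ω) ∂P)
    - hsInner e (covOp P Y₁ (fun ω => conjVec e (Y₄ ω)))
        (covOp P Y₃ (fun ω => conjVec e (Y₂ ω)))

/-- `X` is a centred second-order stationary random field on `ℤ^d`: square integrable, of mean
zero, with covariance and pseudo-covariance operators depending on the lag only. -/
structure IsSecondOrderStationary (e : HilbertBasis ι ℂ H) (P : Measure Ω)
    (X : (Fin d → ℤ) → Ω → H) : Prop where
  memLp_two : ∀ t, MemLp (X t) 2 P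
  mean_zero : ∀ t, ∫ ω, X t ω ∂P = 0
  cov_shift : ∀ t s τ, covOp P (X (t + τ)) (X (s + τ)) = covOp P (X t) (X s)
  pseudoCov_shift : ∀ t s τ,
    covOp P (X (t + τ)) (fun ω => conjVec e (X (s + τ) ω))
      = covOp P (X t) (fun ω => conjVec e (X s ω))

/-- `X` takes values in the real part of `H` (with respect to the basis `e`). -/
def IsRealField (e : HilbertBasis ι ℂ H) (P : Measure Ω) (X : (Fin d → ℤ) → Ω → H) : Prop :=
  ∀ t, ∀ᵐ ω ∂P, conjVec e (X t ω) = X t ω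

/-- The stationary covariance operator `C(h) = E[X(h) ⊗ X(0)]`. -/
def autoCov (P : Measure Ω) (X : (Fin d → ℤ) → Ω → H) (h : Fin d → ℤ) : H →L[ℂ] H :=
  covOp P (X h) (X 0)

/-- `sup_w ∑_u ∑_v |cum(X(u), X(v), X(w), X(0))| ∈ [0, ∞]`. -/
def cumulantSum (e : HilbertBasis ι ℂ H) (P : Measure Ω) (X : (Fin d → ℤ) → Ω → H) : ℝ≥0∞ :=
  ⨆ w : Fin d → ℤ, ∑' u : Fin d → ℤ, ∑' v : Fin d → ℤ, ‖cum4 e P (X u) (X v) (X w) (X 0)‖ₑ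

/-- The standing conditions on the observed random field on `ℤ^d`. -/
structure IsRegularField (e : HilbertBasis ι ℂ H) (P : Measure Ω)
    (X : (Fin d → ℤ) → Ω → H) : Prop where
  stationary : IsSecondOrderStationary e P X
  real : IsRealField e P X
  summable_cov : ∑' k, traceNorm e (autoCov P X k) < ∞
  memLp_four : ∀ t, MemLp (X t) 4 P
  cum_shift : ∀ t s w v τ,
    cum4 e P (X (t + τ)) (X (s + τ)) (X (w + τ)) (X (v + τ)) = cum4 e P (X t) (X s) (X w) (X v)
  cum_summable : cumulantSum e P X < ∞

end RandomField

/-! ### Spectral densities and the power-law class -/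

section Spectral

variable {H : Type*} [NormedAddCommGroup H] [InnerProductSpace ℂ H] [CompleteSpace H]
variable {ι : Type*} {d : ℕ}

/-- A lattice point as a point of Euclidean space. -/
def latticePt (k : Fin d → ℤ) : EuclideanSpace ℝ (Fin d) :=
  WithLp.toLp 2 (fun i => (k i : ℝ))

/-- The character `e^{i kᵀθ}`. -/
def character (k : Fin d → ℤ) (θ : Fin d → ℝ) : ℂ :=
  Complex.exp (Complex.I * ((∑ i, (k i : ℝ) * θ i : ℝ) : ℂ))

/-- The operator-valued Fourier series `θ ↦ (2π)^{-d} ∑_k e^{i kᵀθ} C(k)`. -/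
def fourierSeries (C : (Fin d → ℤ) → H →L[ℂ] H) (θ : Fin d → ℝ) : H →L[ℂ] H :=
  (((2 * Real.pi) ^ d : ℝ) : ℂ)⁻¹ • ∑' k, character k θ • C k

/-- The spectral density of a second-order stationary random field on `ℤ^d`. -/
def spectralDensity {Ω : Type*} [MeasurableSpace Ω] (P : Measure Ω)
    (X : (Fin d → ℤ) → Ω → H) : (Fin d → ℝ) → H →L[ℂ] H :=
  fourierSeries (autoCov P X)

/-- The power-law decay class `𝒫_D(β, L)`. -/
def powerLawClass (e : HilbertBasis ι ℂ H) (d : ℕ) (β L : ℝ) :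
    Set ((Fin d → ℝ) → H →L[ℂ] H) :=
  {f | ∃ C : (Fin d → ℤ) → H →L[ℂ] H, f = fourierSeries C ∧
    ∑' k, traceNorm e (C k) * ENNReal.ofReal (1 + ‖latticePt k‖ ^ β) ≤ ENNReal.ofReal L}

end Spectral

/-! ### Kernels -/

section Kernel

variable {d : ℕ}

/-- The set `S_K = {t | K t > 0}`. -/
def kernelSupport (K : EuclideanSpace ℝ (Fin d) → ℝ) : Set (EuclideanSpace ℝ (Fin d)) :=
  {t | 0 < K t}

/-- The standard conditions on the kernel. -/
structure IsKernel (K : EuclideanSpace ℝ (Fin d) → ℝ) : Prop where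
  continuous : Continuous K
  nonneg : ∀ u, 0 ≤ K u
  bounded_support : Bornology.IsBounded (kernelSupport K)
  map_zero : K 0 = 1
  le_one : ∀ u, K u ≤ 1
  gradient_bounded : ∃ ε > 0, (∀ u ∈ Metric.ball 0 ε, DifferentiableAt ℝ K u) ∧
    ∃ B : ℝ, ∀ u ∈ Metric.ball 0 ε, ‖gradient K u‖ ≤ B

/-- The iterated partial derivative of `K` in the coordinate directions listed in `a`. A list in
which the index `i` occurs `α i` times gives the derivative `∂^α`, whose order `|α|` is the length
of the list. -/
def iterPartial (K : EuclideanSpace ℝ (Fin d) → ℝ) :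
    List (Fin d) → EuclideanSpace ℝ (Fin d) → ℝ
  | [] => K
  | i :: a => fun x => lineDeriv ℝ (iterPartial K a) x (EuclideanSpace.single i 1)

/-- `K` is flat to order `r` at the origin: all partial derivatives up to order `r + 1` exist
everywhere, those of orders `1, …, r` vanish at `0` and those of order `r + 1` are bounded. -/
structure IsFlatToOrder (K : EuclideanSpace ℝ (Fin d) → ℝ) (r : ℕ) : Prop where
  exists_partial : ∀ a : List (Fin d), a.length ≤ r → ∀ (i : Fin d) (x : EuclideanSpace ℝ (Fin d)),
    LineDifferentiableAt ℝ (iterPartial K a) x (EuclideanSpace.single i 1)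
  partial_zero : ∀ a : List (Fin d), 1 ≤ a.length → a.length ≤ r → iterPartial K a 0 = 0
  partial_bounded : ∀ a : List (Fin d), a.length = r + 1 → ∃ B : ℝ, ∀ x, |iterPartial K a x| ≤ B

end Kernel

/-! ### The estimator -/

section Estimator

variable {H : Type*} [NormedAddCommGroup H] [InnerProductSpace ℂ H] [CompleteSpace H]
variable {Ω : Type*} {d : ℕ}

/-- The sampling grid `{1, …, N_1} × ⋯ × {1, …, N_d}`. -/
def grid (N : Fin d → ℕ) : Finset (Fin d → ℤ) :=
  Finset.Icc 1 (fun i => (N i : ℤ))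

/-- The sampling region `[0, N_1] × ⋯ × [0, N_d]`. -/
def region (N : Fin d → ℕ) : Set (Fin d → ℝ) :=
  Set.Icc 0 (fun i => (N i : ℝ))

/-- The Lebesgue measure `|T ∩ (T - h)|`, where `T` is the sampling region. -/
def overlap (N : Fin d → ℕ) (h : Fin d → ℤ) : ℝ :=
  (volume (region N ∩ {x | x + (fun i => (h i : ℝ)) ∈ region N})).toReal

/-- The lag-window estimator of the spectral density with kernel `K` and bandwidth `Δ`. -/
def estimator (K : EuclideanSpace ℝ (Fin d) → ℝ) (N : Fin d → ℕ) (Δ : ℝ)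
    (X : (Fin d → ℤ) → Ω → H) (θ : Fin d → ℝ) (ω : Ω) : H →L[ℂ] H :=
  (((2 * Real.pi) ^ d : ℝ) : ℂ)⁻¹ • ∑ t ∈ grid N, ∑ s ∈ grid N,
    (character (t - s) θ * ((K (Δ⁻¹ • latticePt (t - s)) / overlap N (t - s) : ℝ) : ℂ)) •
      InnerProductSpace.rankOne ℂ (X t ω) (X s ω)

end Estimator

end SpectralDensity

end

open SpectralDensity

/-!
The bias `E f̂ - f` is the Fourier series of `(K(h/Δ) - 1) C(h)`, because the number of pairs of
grid points with lag `h` is exactly the Lebesgue measure of the overlap of the sampling region with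
its translate. Flatness at `0` gives `|K u - 1| ≤ c ‖u‖ ^ β` for all `u`, and the trace norms of
`(1 + ‖h‖ ^ β) C(h)` sum to at most `L`.

For the variance, Hilbert–Schmidt operators are identified with square-summable families of vectors,
so `f̂ - E f̂` is a finite combination of centred random vectors `X(t) ⊗ X(s)` in a Hilbert space.
Schur's test bounds its second moment by the sum of squared coefficients times the row sums of the
matrix of scalar covariances, each of which is a fourth-order cumulant plus two traces of products
of covariance operators; these row sums are at most `M + 2 L ^ 2`. The squared coefficients add up
to `∑ K(h/Δ) ^ 2 / |T ∩ (T - h)|`, which is `O(Δ ^ d / |T|)` even though the denominators may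
degenerate near the boundary of the difference set: since `K` is Lipschitz and vanishes at the
lattice points outside `T - T`, each factor `N l - |h l|` of the overlap controls `K(h/Δ)`.
-/

noncomputable section

namespace SpectralDensity

/-! ### Hilbert-Schmidt and trace norms -/

section Operators

open ContinuousLinearMap (adjoint adjoint_inner_left adjoint_inner_right)

variable {ι : Type*} {H : Type*} [NormedAddCommGroup H]

theorem enorm_sq_eq_tsum (v : lp (fun _ : ι => H) 2) : ‖v‖ₑ ^ 2 = ∑' j, ‖v j‖ₑ ^ 2 := by
  have h := lp.hasSum_norm (p := 2) (by norm_num) v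
  simp only [ENNReal.toReal_ofNat, Real.rpow_ofNat] at h
  have h' := ENNReal.ofReal_tsum_of_nonneg (fun j => by positivity) h.summable
  rw [h.tsum_eq] at h'
  simpa only [ENNReal.ofReal_pow (norm_nonneg _), ofReal_norm] using h'

variable [InnerProductSpace ℂ H]

theorem enorm_inner_le (x y : H) : ‖inner ℂ x y‖ₑ ≤ ‖x‖ₑ * ‖y‖ₑ := by
  simpa only [enorm, ← ENNReal.coe_mul, ENNReal.coe_le_coe] using nnnorm_inner_le_nnnorm x y

theorem tsum_enorm_inner_sq (e : HilbertBasis ι ℂ H) (x : H) :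
    ∑' j, ‖inner ℂ (e j) x‖ₑ ^ 2 = ‖x‖ₑ ^ 2 := by
  rw [← e.repr.enorm_map x, enorm_sq_eq_tsum]
  simp only [e.repr_apply_apply]

theorem hsNorm_sq (e : HilbertBasis ι ℂ H) (T : H →L[ℂ] H) :
    hsNorm e T ^ 2 = ∑' j, ‖T (e j)‖ₑ ^ 2 := by
  rw [hsNorm, ← ENNReal.rpow_natCast, ← ENNReal.rpow_mul]
  norm_num

theorem hsNorm_mul_le (e : HilbertBasis ι ℂ H) (A B : H →L[ℂ] H) :
    hsNorm e (A * B) ≤ ‖A‖ₑ * hsNorm e B := by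
  refine (ENNReal.pow_le_pow_left_iff two_ne_zero).1 ?_
  rw [mul_pow, hsNorm_sq, hsNorm_sq, ← ENNReal.tsum_mul_left]
  refine ENNReal.tsum_le_tsum fun j => ?_
  rw [← mul_pow]
  gcongr
  exact A.le_opENorm _

theorem tsum_enorm_inner_le_hsNorm_mul (e : HilbertBasis ι ℂ H) (A B : H →L[ℂ] H) :
    ∑' j, ‖inner ℂ (A (e j)) (B (e j))‖ₑ ≤ hsNorm e A * hsNorm e B := by
  refine ENNReal.summable.tsum_le_of_sum_le fun F => ?_
  calc ∑ j ∈ F, ‖inner ℂ (A (e j)) (B (e j))‖ₑ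
      ≤ ∑ j ∈ F, ‖A (e j)‖ₑ * ‖B (e j)‖ₑ :=
        Finset.sum_le_sum fun j _ => enorm_inner_le _ _
    _ ≤ (∑ j ∈ F, ‖A (e j)‖ₑ ^ (2 : ℝ)) ^ (1 / 2 : ℝ)
          * (∑ j ∈ F, ‖B (e j)‖ₑ ^ (2 : ℝ)) ^ (1 / 2 : ℝ) :=
        ENNReal.inner_le_Lp_mul_Lq F _ _ Real.HolderConjugate.two_two
    _ ≤ hsNorm e A * hsNorm e B := by
        simp only [ENNReal.rpow_ofNat]
        unfold hsNorm
        gcongr <;> exact ENNReal.sum_le_tsum F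

variable [CompleteSpace H]

theorem enorm_adjoint (T : H →L[ℂ] H) : ‖adjoint T‖ₑ = ‖T‖ₑ :=
  LinearIsometryEquiv.enorm_map _ T

theorem hsNorm_adjoint (e : HilbertBasis ι ℂ H) (T : H →L[ℂ] H) :
    hsNorm e (adjoint T) = hsNorm e T := by
  unfold hsNorm
  simp_rw [← tsum_enorm_inner_sq e (T _), ← tsum_enorm_inner_sq e (adjoint T _)]
  rw [ENNReal.tsum_comm]
  simp_rw [adjoint_inner_right, ← inner_conj_symm (e _) (T _), RCLike.enorm_conj]

theorem hsNorm_mul_le' (e : HilbertBasis ι ℂ H) (A B : H →L[ℂ] H) :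
    hsNorm e (A * B) ≤ hsNorm e A * ‖B‖ₑ := by
  have h := hsNorm_mul_le e (adjoint B) (adjoint A)
  rwa [← ContinuousLinearMap.star_eq_adjoint A, ← ContinuousLinearMap.star_eq_adjoint B,
    ← star_mul, ContinuousLinearMap.star_eq_adjoint, ContinuousLinearMap.star_eq_adjoint,
    ContinuousLinearMap.star_eq_adjoint, enorm_adjoint, hsNorm_adjoint, hsNorm_adjoint,
    mul_comm] at h

theorem enorm_le_hsNorm (e : HilbertBasis ι ℂ H) (T : H →L[ℂ] H) : ‖T‖ₑ ≤ hsNorm e T := by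
  refine T.opENorm_le_bound fun x => (ENNReal.pow_le_pow_left_iff two_ne_zero).1 ?_
  rw [← hsNorm_adjoint, mul_pow, hsNorm_sq, ← tsum_enorm_inner_sq e (T x),
    ← ENNReal.tsum_mul_right]
  refine ENNReal.tsum_le_tsum fun j => ?_
  rw [← adjoint_inner_left, ← mul_pow]
  gcongr
  exact enorm_inner_le _ _

theorem adjoint_abs (T : H →L[ℂ] H) : adjoint (CFC.abs T) = CFC.abs T :=
  (CFC.abs_nonneg T).isSelfAdjoint.star_eq

theorem norm_abs_apply (T : H →L[ℂ] H) (x : H) : ‖CFC.abs T x‖ = ‖T x‖ := by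
  have inner_eq : inner ℂ (CFC.abs T x) (CFC.abs T x) = inner ℂ (T x) (T x) := by
    rw [← adjoint_inner_left, adjoint_abs, ← adjoint_inner_left T]
    exact congrArg (fun A : H →L[ℂ] H => inner ℂ (A x) x) (CFC.abs_mul_abs T)
  rw [norm_eq_sqrt_re_inner (𝕜 := ℂ), inner_eq, ← norm_eq_sqrt_re_inner]

theorem hsNorm_abs (e : HilbertBasis ι ℂ H) (T : H →L[ℂ] H) :
    hsNorm e (CFC.abs T) = hsNorm e T := by
  simp only [hsNorm, ← ofReal_norm, norm_abs_apply]

theorem adjoint_sqrt_abs (T : H →L[ℂ] H) :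
    adjoint (CFC.sqrt (CFC.abs T)) = CFC.sqrt (CFC.abs T) :=
  (CFC.sqrt_nonneg (CFC.abs T)).isSelfAdjoint.star_eq

theorem sqrt_abs_mul_self (T : H →L[ℂ] H) :
    CFC.sqrt (CFC.abs T) * CFC.sqrt (CFC.abs T) = CFC.abs T :=
  CFC.sqrt_mul_sqrt_self _ (CFC.abs_nonneg T)

theorem traceNorm_eq_hsNorm_sq (e : HilbertBasis ι ℂ H) (T : H →L[ℂ] H) :
    traceNorm e T = hsNorm e (CFC.sqrt (CFC.abs T)) ^ 2 := by
  rw [hsNorm_sq]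
  refine tsum_congr fun j => ?_
  rw [← ofReal_norm, ← ENNReal.ofReal_pow (norm_nonneg _), norm_sq_eq_re_inner (𝕜 := ℂ),
    ← adjoint_inner_left, adjoint_sqrt_abs, ← mul_apply_eq_comp,
    sqrt_abs_mul_self]

theorem hsNorm_le_traceNorm (e : HilbertBasis ι ℂ H) (T : H →L[ℂ] H) :
    hsNorm e T ≤ traceNorm e T := by
  calc hsNorm e T = hsNorm e (CFC.sqrt (CFC.abs T) * CFC.sqrt (CFC.abs T)) := by
        rw [sqrt_abs_mul_self, hsNorm_abs]
    _ ≤ hsNorm e (CFC.sqrt (CFC.abs T)) * hsNorm e (CFC.sqrt (CFC.abs T)) := by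
        refine (hsNorm_mul_le e _ _).trans ?_
        gcongr
        exact enorm_le_hsNorm e _
    _ = traceNorm e T := by rw [traceNorm_eq_hsNorm_sq, sq]

theorem norm_abs_apply_le_norm_add_smul (T : H →L[ℂ] H) {ε : ℝ} (hε : 0 ≤ ε) (x : H) :
    ‖T x‖ ≤ ‖(CFC.abs T + (ε : ℂ) • (1 : H →L[ℂ] H)) x‖ := by
  have abs_pos : 0 ≤ RCLike.re (inner ℂ (CFC.abs T x) x) :=
    ((ContinuousLinearMap.nonneg_iff_isPositive _).1 (CFC.abs_nonneg T)).re_inner_nonneg_left x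
  rw [← norm_abs_apply]
  refine le_of_sq_le_sq ?_ (norm_nonneg _)
  calc ‖CFC.abs T x‖ ^ 2
      ≤ ‖CFC.abs T x‖ ^ 2 + 2 * (ε * RCLike.re (inner ℂ (CFC.abs T x) x)) + (ε * ‖x‖) ^ 2 := by
        have := mul_nonneg hε abs_pos
        nlinarith [sq_nonneg (ε * ‖x‖)]
    _ = ‖CFC.abs T x + (ε : ℂ) • x‖ ^ 2 := by
        rw [norm_add_sq (𝕜 := ℂ), inner_smul_right, norm_smul]
        simp [mul_pow]

theorem isUnit_abs_add_smul_one (T : H →L[ℂ] H) {ε : ℝ} (hε : 0 < ε) :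
    IsUnit (CFC.abs T + (ε : ℂ) • (1 : H →L[ℂ] H)) := by
  have unit : IsUnit ((ε : ℂ) • (1 : H →L[ℂ] H)) :=
    isUnit_one.smul (Units.mk0 (ε : ℂ) (by exact_mod_cast hε.ne'))
  have nonneg : (0 : H →L[ℂ] H) ≤ (ε : ℂ) • (1 : H →L[ℂ] H) := by
    rw [Complex.coe_smul]
    exact smul_nonneg hε.le zero_le_one
  exact CStarAlgebra.isUnit_of_le _ (le_add_of_nonneg_left (CFC.abs_nonneg T))
    (unit.isStrictlyPositive nonneg)

/- Replacing `|T|` by the invertible operator `|T| + ε` avoids partial isometries. -/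
theorem exists_approx_polar (T : H →L[ℂ] H) {ε : ℝ} (hε : 0 < ε) :
    ∃ U : H →L[ℂ] H, ‖U‖ ≤ 1 ∧ T = U * CFC.abs T + (ε : ℂ) • U := by
  obtain ⟨R, hR⟩ := isUnit_abs_add_smul_one T hε
  refine ⟨T * ↑R⁻¹, ContinuousLinearMap.opNorm_le_bound _ zero_le_one fun x => ?_, ?_⟩
  · calc ‖T ((↑R⁻¹ : H →L[ℂ] H) x)‖
        ≤ ‖(R : H →L[ℂ] H) ((↑R⁻¹ : H →L[ℂ] H) x)‖ :=
          hR ▸ norm_abs_apply_le_norm_add_smul T hε.le _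
      _ = 1 * ‖x‖ := by rw [← mul_apply_eq_comp, R.mul_inv, one_mul]; rfl
  · calc T = T * (↑R⁻¹ * (CFC.abs T + (ε : ℂ) • (1 : H →L[ℂ] H))) := by
          rw [← hR, R.inv_mul, mul_one]
      _ = _ := by simp [mul_add, mul_assoc]

theorem tsum_enorm_inner_mul_abs_le (e : HilbertBasis ι ℂ H) (U T : H →L[ℂ] H) :
    ∑' j, ‖inner ℂ (e j) ((U * CFC.abs T) (e j))‖ₑ ≤ ‖U‖ₑ * traceNorm e T := by
  set S := CFC.sqrt (CFC.abs T) with hS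
  have factor : ∀ x, inner ℂ x ((U * CFC.abs T) x) = inner ℂ ((S * adjoint U) x) (S x) := by
    intro x
    rw [← sqrt_abs_mul_self, ← hS]
    calc inner ℂ x (U (S (S x))) = inner ℂ (adjoint S (adjoint U x)) (S x) := by
          rw [adjoint_inner_left, adjoint_inner_left]
      _ = _ := by rw [hS, adjoint_sqrt_abs]; rfl
  simp_rw [factor]
  refine (tsum_enorm_inner_le_hsNorm_mul e _ _).trans ?_
  rw [traceNorm_eq_hsNorm_sq, sq, ← mul_assoc]
  gcongr
  exact (hsNorm_mul_le' e _ _).trans_eq (by rw [enorm_adjoint, mul_comm])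

theorem tsum_enorm_inner_le_traceNorm (e : HilbertBasis ι ℂ H) (T : H →L[ℂ] H) :
    ∑' j, ‖inner ℂ (e j) (T (e j))‖ₑ ≤ traceNorm e T := by
  refine ENNReal.summable.tsum_le_of_sum_le fun F =>
    ENNReal.le_of_forall_pos_le_add fun δ hδ _ => ?_
  set ε : ℝ≥0 := δ / (F.card + 1) with hε
  obtain ⟨U, hU, hTU⟩ := exists_approx_polar T (ε := ε) (by positivity)
  replace hU : ‖U‖ₑ ≤ 1 := by rw [← ofReal_norm]; exact ENNReal.ofReal_le_one.2 hU
  have norm_basis : ∀ j, ‖e j‖ₑ = 1 := fun j => by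
    rw [← ofReal_norm, e.orthonormal.1 j, ENNReal.ofReal_one]
  have remainder : ∀ j, ‖inner ℂ (e j) ((((ε : ℝ) : ℂ) • U) (e j))‖ₑ ≤ ε := by
    intro j
    calc ‖inner ℂ (e j) ((((ε : ℝ) : ℂ) • U) (e j))‖ₑ
        ≤ ‖e j‖ₑ * (‖((ε : ℝ) : ℂ)‖ₑ * (‖U‖ₑ * ‖e j‖ₑ)) := by
          rw [smul_apply]
          exact (enorm_inner_le _ _).trans (by rw [enorm_smul]; gcongr; exact U.le_opENorm _)
      _ ≤ ε := by
          rw [norm_basis, one_mul, mul_one]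
          refine (mul_le_of_le_one_right' hU).trans_eq ?_
          rw [← ofReal_norm, Complex.norm_real, NNReal.norm_eq, ENNReal.ofReal_coe_nnreal]
  calc ∑ j ∈ F, ‖inner ℂ (e j) (T (e j))‖ₑ
      ≤ ∑ j ∈ F, (‖inner ℂ (e j) ((U * CFC.abs T) (e j))‖ₑ + ε) := by
        refine Finset.sum_le_sum fun j _ => ?_
        conv_lhs => rw [hTU, add_apply, inner_add_right]
        exact (enorm_add_le _ _).trans (by gcongr; exact remainder j)
    _ ≤ ‖U‖ₑ * traceNorm e T + F.card * ε := by
        rw [Finset.sum_add_distrib, Finset.sum_const, nsmul_eq_mul]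
        gcongr
        exact (ENNReal.sum_le_tsum F).trans (tsum_enorm_inner_mul_abs_le e U T)
    _ ≤ traceNorm e T + δ := by
        gcongr
        · exact mul_le_of_le_one_left' hU
        · have card_mul_le : (F.card : ℝ≥0) * ε ≤ δ := by
            rw [hε, mul_div_assoc', div_le_iff₀ (add_pos_of_nonneg_of_pos zero_le zero_lt_one),
              mul_comm]
            gcongr
            exact le_self_add
          exact_mod_cast card_mul_le

end Operators

/-! ### Hilbert-Schmidt operators as square-summable families -/

section HilbertSchmidt

open InnerProductSpace (rankOne)

variable {ι : Type*} {H : Type*} [NormedAddCommGroup H]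

theorem memℓp_two_of_tsum_enorm_sq {f : ι → H} (h : ∑' j, ‖f j‖ₑ ^ 2 ≠ ∞) :
    Memℓp f 2 := by
  refine memℓp_gen ?_
  simpa using ENNReal.summable_toReal h

variable [InnerProductSpace ℂ H]

/-- The square-summable family `v` consists of the images of the basis vectors under `T`. This
identifies the Hilbert-Schmidt operators with the Hilbert space `ℓ²(ι, H)`. -/
def RepresentsHS (e : HilbertBasis ι ℂ H) (T : H →L[ℂ] H) (v : lp (fun _ : ι => H) 2) : Prop :=
  ∀ j, v j = T (e j)

theorem exists_representsHS {e : HilbertBasis ι ℂ H} {T : H →L[ℂ] H} (hT : hsNorm e T ≠ ∞) :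
    ∃ v, RepresentsHS e T v :=
  ⟨⟨fun j => T (e j), memℓp_two_of_tsum_enorm_sq
    (by rw [← hsNorm_sq]; exact ENNReal.pow_ne_top hT)⟩, fun _ => rfl⟩

namespace RepresentsHS

variable {e : HilbertBasis ι ℂ H} {A B : H →L[ℂ] H} {v w : lp (fun _ : ι => H) 2}

theorem hsNorm_eq (h : RepresentsHS e A v) : hsNorm e A = ‖v‖ₑ := by
  refine (ENNReal.pow_right_strictMono two_ne_zero).injective ?_
  simp only [hsNorm_sq, enorm_sq_eq_tsum, h _]

theorem hsInner_eq (hA : RepresentsHS e A v) (hB : RepresentsHS e B w) :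
    hsInner e A B = inner ℂ v w := by
  simp only [lp.inner_eq_tsum, hsInner, hA _, hB _]

theorem add (hA : RepresentsHS e A v) (hB : RepresentsHS e B w) :
    RepresentsHS e (A + B) (v + w) := fun j => by
  simp [hA j, hB j]

theorem sub (hA : RepresentsHS e A v) (hB : RepresentsHS e B w) :
    RepresentsHS e (A - B) (v - w) := fun j => by
  simp [hA j, hB j]

theorem smul (hA : RepresentsHS e A v) (c : ℂ) : RepresentsHS e (c • A) (c • v) := fun j => by
  simp [hA j]

theorem sum {κ : Type*} {s : Finset κ} {A : κ → H →L[ℂ] H} {v : κ → lp (fun _ : ι => H) 2}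
    (h : ∀ k ∈ s, RepresentsHS e (A k) (v k)) :
    RepresentsHS e (∑ k ∈ s, A k) (∑ k ∈ s, v k) := fun j => by
  rw [lp.coeFn_sum, Finset.sum_apply, sum_apply]
  exact Finset.sum_congr rfl fun k hk => h k hk j

theorem tsum [CompleteSpace H] {κ : Type*} {A : κ → H →L[ℂ] H} {v : κ → lp (fun _ : ι => H) 2}
    (hA : Summable A) (hv : Summable v) (h : ∀ k, RepresentsHS e (A k) (v k)) :
    RepresentsHS e (∑' k, A k) (∑' k, v k) := fun j => by
  calc (∑' k, v k) j = ∑' k, v k j :=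
        (lp.evalCLM ℂ (fun _ : ι => H) 2 j).map_tsum hv
    _ = ∑' k, A k (e j) := tsum_congr fun k => h k j
    _ = (∑' k, A k) (e j) := ((ContinuousLinearMap.apply ℂ H (e j)).map_tsum hA).symm

end RepresentsHS

theorem hsNorm_smul (e : HilbertBasis ι ℂ H) (c : ℂ) (A : H →L[ℂ] H) :
    hsNorm e (c • A) = ‖c‖ₑ * hsNorm e A := by
  refine (ENNReal.pow_right_strictMono two_ne_zero).injective ?_
  simp only [hsNorm_sq, mul_pow, smul_apply, enorm_smul, ENNReal.tsum_mul_left]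

theorem hsNorm_add_le (e : HilbertBasis ι ℂ H) (A B : H →L[ℂ] H) :
    hsNorm e (A + B) ≤ hsNorm e A + hsNorm e B := by
  by_cases h : hsNorm e A + hsNorm e B = ∞
  · exact h ▸ le_top
  obtain ⟨v, hv⟩ := exists_representsHS (ENNReal.add_ne_top.1 h).1
  obtain ⟨w, hw⟩ := exists_representsHS (ENNReal.add_ne_top.1 h).2
  rw [(hv.add hw).hsNorm_eq, hv.hsNorm_eq, hw.hsNorm_eq]
  exact enorm_add_le v w

theorem hsNorm_tsum_le [CompleteSpace H] {κ : Type*} (e : HilbertBasis ι ℂ H)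
    (A : κ → H →L[ℂ] H) : hsNorm e (∑' k, A k) ≤ ∑' k, hsNorm e (A k) := by
  by_cases h : ∑' k, hsNorm e (A k) = ∞
  · exact h ▸ le_top
  choose v hv using fun k => exists_representsHS (ENNReal.ne_top_of_tsum_ne_top h k)
  simp_rw [fun k => (hv k).hsNorm_eq] at h ⊢
  have summable_family : Summable v := .of_enorm h
  have summable_op : Summable A := .of_enorm <| ne_top_of_le_ne_top h <|
    ENNReal.tsum_le_tsum fun k => (enorm_le_hsNorm e (A k)).trans_eq (hv k).hsNorm_eq
  rw [(RepresentsHS.tsum summable_op summable_family hv).hsNorm_eq]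
  exact enorm_tsum_le_tsum_enorm

theorem countable_of_hilbertBasis [TopologicalSpace.SeparableSpace H] (e : HilbertBasis ι ℂ H) :
    Countable ι := by
  have disjoint_balls :
      Pairwise (Function.onFun Disjoint fun i => Metric.ball (e i) (1 / 2)) := by
    intro i j hij
    refine Metric.ball_disjoint_ball ?_
    have h : ‖e i - e j‖ ^ 2 = 2 := by
      rw [@norm_sub_sq ℂ, e.orthonormal.1 i, e.orthonormal.1 j, e.orthonormal.2 hij]
      norm_num
    rw [dist_eq_norm]
    nlinarith [norm_nonneg (e i - e j)]
  exact disjoint_balls.countable_of_isOpen_disjoint (fun i => Metric.isOpen_ball)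
    (fun i => ⟨e i, Metric.mem_ball_self (by norm_num)⟩)

theorem hsNorm_rankOne (e : HilbertBasis ι ℂ H) (x y : H) :
    hsNorm e (rankOne ℂ x y) = ‖x‖ₑ * ‖y‖ₑ := by
  refine (ENNReal.pow_right_strictMono two_ne_zero).injective ?_
  simp only [hsNorm_sq, InnerProductSpace.rankOne_apply, enorm_smul, mul_pow,
    ENNReal.tsum_mul_right, ← inner_conj_symm y (e _), RCLike.enorm_conj, tsum_enorm_inner_sq]
  exact mul_comm _ _

/-- The family representing the operator `x ⊗ y`. -/
def hsRankOneFamily (e : HilbertBasis ι ℂ H) (x y : H) : lp (fun _ : ι => H) 2 :=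
  ⟨fun j => rankOne ℂ x y (e j), memℓp_two_of_tsum_enorm_sq <| by
    rw [← hsNorm_sq, hsNorm_rankOne]
    finiteness⟩

theorem norm_hsRankOneFamily (e : HilbertBasis ι ℂ H) (x y : H) :
    ‖hsRankOneFamily e x y‖ = ‖x‖ * ‖y‖ := by
  have represents : RepresentsHS e (rankOne ℂ x y) (hsRankOneFamily e x y) := fun _ => rfl
  have h := represents.hsNorm_eq.symm.trans (hsNorm_rankOne e x y)
  simpa using congrArg ENNReal.toReal h

/-- The sesquilinear map sending `x`, `y` to the family representing `x ⊗ y`. -/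
def hsRankOne (e : HilbertBasis ι ℂ H) : H →L[ℂ] H →L⋆[ℂ] lp (fun _ : ι => H) 2 :=
  LinearMap.mkContinuous₂
    (LinearMap.mk₂'ₛₗ (RingHom.id ℂ) (starRingEnd ℂ) (hsRankOneFamily e)
      (fun x x' y => by ext j; exact smul_add (inner ℂ y (e j)) x x')
      (fun c x y => by ext j; exact smul_comm (inner ℂ y (e j)) c x)
      (fun x y y' => by
        ext j
        exact (congrArg (· • x) (inner_add_left y y' (e j))).trans (add_smul _ _ x))
      (fun c x y => by
        ext j
        exact (congrArg (· • x) (inner_smul_left y (e j) c)).trans (mul_smul _ _ x)))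
    1 (fun x y => by rw [one_mul]; exact (norm_hsRankOneFamily e x y).le)

theorem representsHS_hsRankOne (e : HilbertBasis ι ℂ H) (x y : H) :
    RepresentsHS e (rankOne ℂ x y) (hsRankOne e x y) :=
  fun _ => rfl

end HilbertSchmidt

/-! ### Uniqueness of Fourier coefficients -/

section Fourier

open UnitAddTorus (mFourier mFourierLp)

local instance : MeasureSpace UnitAddCircle := ⟨AddCircle.haarAddCircle⟩

local instance : IsProbabilityMeasure (volume : Measure UnitAddCircle) :=
  inferInstanceAs (IsProbabilityMeasure AddCircle.haarAddCircle)

variable {d : ℕ}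

theorem norm_character (k : Fin d → ℤ) (θ : Fin d → ℝ) : ‖character k θ‖ = 1 := by
  rw [character, mul_comm, Complex.norm_exp_ofReal_mul_I]

theorem character_two_pi_mul (k : Fin d → ℤ) (x : Fin d → ℝ) :
    character k (fun i => 2 * Real.pi * x i) = mFourier k (fun i => (x i : UnitAddCircle)) := by
  simp only [character, mFourier, ContinuousMap.coe_mk, fourier_coe_apply, ← Complex.exp_sum]
  congr 1
  push_cast
  rw [Finset.mul_sum]
  exact Finset.sum_congr rfl fun i _ => by ring

theorem norm_mFourier_apply (k : Fin d → ℤ) (t : UnitAddTorus (Fin d)) : ‖mFourier k t‖ = 1 := by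
  rw [mFourier, ContinuousMap.coe_mk, norm_prod]
  exact Finset.prod_eq_one fun i _ => Circle.norm_coe _

theorem integral_mFourier_neg_mul (k n : Fin d → ℤ) :
    ∫ t, mFourier (-n) t * mFourier k t = if n = k then 1 else 0 := by
  rw [← orthonormal_iff_ite.1 (UnitAddTorus.orthonormal_mFourier (d := Fin d)) n k, mFourierLp,
    mFourierLp, ContinuousMap.inner_toLp]
  simp only [UnitAddTorus.mFourier_neg, mul_comm]

variable {E : Type*} [NormedAddCommGroup E] [NormedSpace ℂ E] [CompleteSpace E]

theorem eq_zero_of_tsum_character_smul_eq_zero {a : (Fin d → ℤ) → E} (ha : Summable fun k => ‖a k‖)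
    (h : ∀ θ, ∑' k, character k θ • a k = 0) : a = 0 := by
  have series_zero : ∀ t, ∑' k, mFourier k t • a k = 0 := by
    intro t
    have ht : (fun i => ((t i).out : UnitAddCircle)) = t := funext fun i => Quotient.out_eq _
    simpa only [character_two_pi_mul, ht] using h fun i => 2 * Real.pi * (t i).out
  funext n
  have norm_term : ∀ k t, ‖(mFourier (-n) t * mFourier k t) • a k‖ = ‖a k‖ := fun k t => by
    rw [norm_smul, norm_mul, norm_mFourier_apply, norm_mFourier_apply, one_mul, one_mul]
  have integrable_term : ∀ k, Integrable fun t => (mFourier (-n) t * mFourier k t) • a k :=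
    fun k => Integrable.of_bound (by fun_prop) ‖a k‖ (.of_forall fun t => (norm_term k t).le)
  calc a n = ∑' k, ∫ t, (mFourier (-n) t * mFourier k t) • a k := by
        simp_rw [integral_smul_const, integral_mFourier_neg_mul, ite_smul, one_smul, zero_smul]
        exact (tsum_ite_eq' n a).symm
    _ = ∫ t, ∑' k, (mFourier (-n) t * mFourier k t) • a k :=
        integral_tsum_of_summable_integral_norm integrable_term (by simpa [norm_term] using ha)
    _ = 0 := by simp_rw [mul_smul, tsum_const_smul'', series_zero, smul_zero, integral_zero]

theorem summable_character_smul {C : (Fin d → ℤ) → E} (hC : Summable fun k => ‖C k‖)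
    (θ : Fin d → ℝ) : Summable fun k => character k θ • C k :=
  .of_norm (by simpa only [norm_smul, norm_character, one_mul] using hC)

variable {H : Type*} [NormedAddCommGroup H] [InnerProductSpace ℂ H]

theorem fourierSeries_sub [CompleteSpace H] {A B : (Fin d → ℤ) → H →L[ℂ] H}
    (hA : Summable fun k => ‖A k‖) (hB : Summable fun k => ‖B k‖) (θ : Fin d → ℝ) :
    fourierSeries (A - B) θ = fourierSeries A θ - fourierSeries B θ := by
  simp_rw [fourierSeries, Pi.sub_apply, smul_sub]
  rw [(summable_character_smul hA θ).tsum_sub (summable_character_smul hB θ), smul_sub]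

theorem fourierSeries_inj [CompleteSpace H] {A B : (Fin d → ℤ) → H →L[ℂ] H}
    (hA : Summable fun k => ‖A k‖) (hB : Summable fun k => ‖B k‖) :
    fourierSeries A = fourierSeries B ↔ A = B := by
  refine ⟨fun h => ?_, fun h => h ▸ rfl⟩
  have summable_sub : Summable fun k => ‖(A - B) k‖ :=
    (hA.add hB).of_nonneg_of_le (fun _ => norm_nonneg _) fun k => norm_sub_le _ _
  refine sub_eq_zero.1 (eq_zero_of_tsum_character_smul_eq_zero summable_sub fun θ => ?_)
  have series_zero : fourierSeries (A - B) θ = 0 := by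
    rw [fourierSeries_sub hA hB, h, sub_self]
  refine (smul_eq_zero_iff_right (inv_ne_zero ?_)).1 series_zero
  exact_mod_cast (by positivity : (2 * Real.pi) ^ d ≠ 0)

theorem enorm_inv_two_pi_pow_le_one (d : ℕ) : ‖(((2 * Real.pi) ^ d : ℝ) : ℂ)⁻¹‖ₑ ≤ 1 := by
  rw [← ofReal_norm, norm_inv, Complex.norm_real, Real.norm_of_nonneg (by positivity)]
  exact ENNReal.ofReal_le_one.2
    (inv_le_one_of_one_le₀ (one_le_pow₀ (by linarith [Real.pi_gt_three])))

theorem hsNorm_fourierSeries_le {ι : Type*} [CompleteSpace H] (e : HilbertBasis ι ℂ H)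
    (C : (Fin d → ℤ) → H →L[ℂ] H) (θ : Fin d → ℝ) :
    hsNorm e (fourierSeries C θ) ≤ ∑' k, hsNorm e (C k) := by
  rw [fourierSeries, hsNorm_smul]
  refine (mul_le_of_le_one_left' (enorm_inv_two_pi_pow_le_one d)).trans <|
    (hsNorm_tsum_le e _).trans_eq (tsum_congr fun k => ?_)
  rw [hsNorm_smul, ← ofReal_norm, norm_character, ENNReal.ofReal_one, one_mul]

end Fourier

/-! ### Kernels -/

section LineDeriv

variable {E : Type*} [NormedAddCommGroup E] [NormedSpace ℝ E] {g : E → ℝ} {v : E}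

theorem abs_add_smul_sub_le_of_lineDeriv_le (hg : ∀ x, LineDifferentiableAt ℝ g x v) {B : ℝ}
    (x : E) (s : ℝ) (hB : ∀ σ ∈ Set.uIcc 0 s, |lineDeriv ℝ g (x + σ • v) v| ≤ B) :
    |g (x + s • v) - g x| ≤ B * |s| := by
  have hasDerivAt_line : ∀ σ,
      HasDerivAt (fun τ : ℝ => g (x + τ • v)) (lineDeriv ℝ g (x + σ • v) v) σ := by
    intro σ
    have at_zero : HasDerivAt (fun τ : ℝ => g (x + σ • v + τ • v))
        (lineDeriv ℝ g (x + σ • v) v) (σ - σ) := by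
      rw [sub_self]
      exact (hg (x + σ • v)).hasLineDerivAt
    refine (at_zero.comp_sub_const σ σ).congr_of_eventuallyEq (.of_forall fun τ => ?_)
    beta_reduce
    congr 1
    module
  simpa using (convex_uIcc (0 : ℝ) s).norm_image_sub_le_of_norm_hasDerivWithin_le
    (fun σ _ => (hasDerivAt_line σ).hasDerivWithinAt) hB Set.left_mem_uIcc Set.right_mem_uIcc

theorem abs_le_of_lineDeriv_le_of_support (hg : ∀ x, LineDifferentiableAt ℝ g x v) (hv : ‖v‖ = 1)
    {B R : ℝ} (hB : ∀ x, |lineDeriv ℝ g x v| ≤ B) (hR : ∀ x, R < ‖x‖ → g x = 0) (x : E) :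
    |g x| ≤ B * |2 * R + 1| := by
  rcases le_or_gt ‖x‖ R with hx | hx
  · have outside : R < ‖x + (2 * R + 1) • v‖ := by
      have := norm_sub_norm_le ((2 * R + 1) • v) (-x)
      rw [norm_smul, norm_neg, sub_neg_eq_add, add_comm _ x, hv, mul_one, Real.norm_eq_abs] at this
      linarith [le_abs_self (2 * R + 1)]
    simpa [hR _ outside] using
      abs_add_smul_sub_le_of_lineDeriv_le hg x (2 * R + 1) fun σ _ => hB _
  · rw [hR x hx, abs_zero]
    exact mul_nonneg ((abs_nonneg _).trans (hB x)) (abs_nonneg _)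

end LineDeriv

section Partials

variable {d : ℕ} {K : EuclideanSpace ℝ (Fin d) → ℝ} {r : ℕ}

theorem abs_sub_le_of_partial_le {g : EuclideanSpace ℝ (Fin d) → ℝ}
    (hg : ∀ i x, LineDifferentiableAt ℝ g x (EuclideanSpace.single i 1))
    (u : EuclideanSpace ℝ (Fin d)) {b : ℝ}
    (hb : ∀ i y, (∀ j, |y j| ≤ |u j|) → |lineDeriv ℝ g y (EuclideanSpace.single i 1)| ≤ b) :
    |g u - g 0| ≤ b * ∑ j, |u j| := by
  let path (s : Finset (Fin d)) : EuclideanSpace ℝ (Fin d) :=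
    WithLp.toLp 2 fun j => if j ∈ s then u j else 0
  have path_insert {i : Fin d} {s : Finset (Fin d)} (hi : i ∉ s) :
      path (insert i s) = path s + u i • EuclideanSpace.single i (1 : ℝ) := by
    ext j
    obtain rfl | hj := eq_or_ne j i <;> simp_all [path]
  have path_le : ∀ s, |g (path s) - g (path ∅)| ≤ b * ∑ j ∈ s, |u j| := by
    intro s
    induction s using Finset.induction_on with
    | empty => simp
    | insert i s hi ih =>
      have step := abs_add_smul_sub_le_of_lineDeriv_le (hg i) (path s) (u i) (B := b) fun σ hσ => by
        have hσ : |σ| ≤ |u i| := by simpa using Set.abs_sub_left_of_mem_uIcc hσ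
        refine hb i _ fun j => ?_
        obtain rfl | hj := eq_or_ne j i
        · simpa [path, hi] using hσ
        · by_cases hjs : j ∈ s <;> simp [path, hj, hjs]
      rw [path_insert hi, Finset.sum_insert hi, mul_add]
      exact (abs_sub_le _ _ _).trans (add_le_add step ih)
  have path_empty : path ∅ = 0 := by ext j; simp [path]
  simpa [path_empty, path] using path_le Finset.univ

theorem exists_uniform_iterPartial_bound (hKr : IsFlatToOrder K r) :
    ∃ B : ℝ, 0 ≤ B ∧ ∀ a : List (Fin d), a.length = r + 1 → ∀ x, |iterPartial K a x| ≤ B := by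
  choose! B hB using hKr.partial_bounded
  obtain ⟨M, hM⟩ := ((List.finite_length_eq (Fin d) (r + 1)).image B).bddAbove
  exact ⟨max M 0, le_max_right _ _, fun a ha x =>
    (hB a ha x).trans ((hM ⟨a, ha, rfl⟩).trans (le_max_left _ _))⟩

theorem exists_abs_sub_le_mul_sum_pow (hKr : IsFlatToOrder K r) :
    ∃ B : ℝ, 0 ≤ B ∧ ∀ u, |K u - K 0| ≤ B * (∑ j, |u j|) ^ (r + 1) := by
  obtain ⟨B, hB0, hB⟩ := exists_uniform_iterPartial_bound hKr
  have mono : ∀ (m : ℕ) (u y : EuclideanSpace ℝ (Fin d)), (∀ j, |y j| ≤ |u j|) →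
      B * (∑ j, |y j|) ^ m ≤ B * (∑ j, |u j|) ^ m := fun m u y h => by
    gcongr B * ?_ ^ m
    exact Finset.sum_le_sum fun j _ => h j
  have partial_le : ∀ (m : ℕ) (a : List (Fin d)), a.length + m = r + 1 → 1 ≤ a.length → ∀ u,
      |iterPartial K a u| ≤ B * (∑ j, |u j|) ^ m := by
    intro m
    induction m with
    | zero => intro a ha _ u; simpa using hB a ha u
    | succ m ih =>
      intro a ha h1 u
      have increment := abs_sub_le_of_partial_le (g := iterPartial K a)
        (fun i x => hKr.exists_partial a (by omega) i x) u (b := B * (∑ j, |u j|) ^ m)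
        (fun i y hy => (ih (i :: a) (by simp; omega) (by simp) y).trans (mono m u y hy))
      simpa [hKr.partial_zero a h1 (by omega), pow_succ, mul_assoc] using increment
  refine ⟨B, hB0, fun u => ?_⟩
  have increment := abs_sub_le_of_partial_le (g := K)
    (fun i x => hKr.exists_partial [] (by simp) i x) u (b := B * (∑ j, |u j|) ^ r)
    (fun i y hy => (partial_le r [i] (by simp; omega) (by simp) y).trans (mono r u y hy))
  rwa [pow_succ, ← mul_assoc]

theorem sum_abs_coord_le (u : EuclideanSpace ℝ (Fin d)) : ∑ j, |u j| ≤ d * ‖u‖ :=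
  (Finset.sum_le_card_nsmul _ _ _ fun j _ => PiLp.norm_apply_le u j).trans_eq (by simp)

theorem exists_abs_kernel_sub_one_le (hK : IsKernel K) (hKr : IsFlatToOrder K r) {β : ℝ}
    (hβ : 0 ≤ β) (hr : β - 1 ≤ r) : ∃ c : ℝ, 0 ≤ c ∧ ∀ u, |K u - 1| ≤ c * ‖u‖ ^ β := by
  obtain ⟨B, hB0, hB⟩ := exists_abs_sub_le_mul_sum_pow hKr
  refine ⟨max 1 (B * (d : ℝ) ^ (r + 1)), by positivity, fun u => ?_⟩
  rcases le_total ‖u‖ 1 with hu | hu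
  · have pow_le : ‖u‖ ^ (r + 1) ≤ ‖u‖ ^ β := by
      rw [← Real.rpow_natCast]
      refine Real.rpow_le_rpow_of_exponent_ge' (norm_nonneg _) hu hβ ?_
      push_cast
      linarith
    calc |K u - 1| ≤ B * (∑ j, |u j|) ^ (r + 1) := hK.map_zero ▸ hB u
      _ ≤ B * (d * ‖u‖) ^ (r + 1) := by gcongr; exact sum_abs_coord_le u
      _ = B * (d : ℝ) ^ (r + 1) * ‖u‖ ^ (r + 1) := by ring
      _ ≤ max 1 (B * (d : ℝ) ^ (r + 1)) * ‖u‖ ^ β := by gcongr; exact le_max_right _ _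
  · have : |K u - 1| ≤ 1 := by
      rw [abs_le]
      constructor <;> linarith [hK.nonneg u, hK.le_one u]
    exact this.trans (one_le_mul_of_one_le_of_one_le (le_max_left _ _) (Real.one_le_rpow hu hβ))

theorem iterPartial_eq_zero_of_norm_gt {R : ℝ} (hR : ∀ u, R < ‖u‖ → K u = 0) :
    ∀ (a : List (Fin d)) (u), R < ‖u‖ → iterPartial K a u = 0
  | [], u, hu => hR u hu
  | i :: a, u, hu => by
    have : iterPartial K a =ᶠ[𝓝 u] 0 := by
      filter_upwards [continuous_norm.continuousAt.eventually (lt_mem_nhds hu)] with x hx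
      exact iterPartial_eq_zero_of_norm_gt hR a x hx
    change lineDeriv ℝ (iterPartial K a) u _ = 0
    rw [this.lineDeriv_eq]
    simp [lineDeriv]

theorem exists_iterPartial_bound (hKr : IsFlatToOrder K r) {R : ℝ}
    (hR : ∀ u, R < ‖u‖ → K u = 0) (m : ℕ) :
    ∀ a : List (Fin d), a.length + m = r + 1 → 1 ≤ a.length →
      ∃ B : ℝ, ∀ x, |iterPartial K a x| ≤ B := by
  induction m with
  | zero => exact fun a ha _ => hKr.partial_bounded a ha
  | succ m ih =>
    intro a ha h1
    have i : Fin d := a.head (List.ne_nil_of_length_pos h1)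
    obtain ⟨B, hB⟩ := ih (i :: a) (by simp; omega) (by simp)
    exact ⟨B * |2 * R + 1|, abs_le_of_lineDeriv_le_of_support
      (fun x => hKr.exists_partial a (by omega) i x) (by simp) hB
      (iterPartial_eq_zero_of_norm_gt hR a)⟩

theorem exists_partial_bound (hKr : IsFlatToOrder K r) {R : ℝ} (hR : ∀ u, R < ‖u‖ → K u = 0) :
    ∃ B : ℝ, 0 ≤ B ∧ ∀ i x, |lineDeriv ℝ K x (EuclideanSpace.single i 1)| ≤ B := by
  choose B hB using fun i : Fin d =>
    exists_iterPartial_bound hKr hR r [i] (by simp; omega) (by simp)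
  refine ⟨∑ i, |B i|, Finset.sum_nonneg fun _ _ => abs_nonneg _, fun i x => ?_⟩
  exact (hB i x).trans <| (le_abs_self _).trans <|
    Finset.single_le_sum (f := fun i => |B i|) (fun _ _ => abs_nonneg _) (Finset.mem_univ i)

theorem exists_radius (hK : IsKernel K) : ∃ R : ℝ, 0 ≤ R ∧ ∀ u, R < ‖u‖ → K u = 0 := by
  obtain ⟨R, hR0, hR⟩ := hK.bounded_support.exists_pos_norm_le
  exact ⟨R, hR0.le, fun u hu => (hK.nonneg u).antisymm' (not_lt.1 fun h => hu.not_ge (hR u h))⟩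

end Partials

section Lags

variable {d : ℕ} {K : EuclideanSpace ℝ (Fin d) → ℝ} {N : Fin d → ℕ} {h : Fin d → ℤ} {Δ : ℝ}

theorem mem_grid_sub_grid : h ∈ grid N - grid N ↔ ∀ l, |h l| < N l := by
  simp only [grid, Finset.mem_sub, Finset.mem_Icc, Pi.le_def, Pi.one_apply]
  constructor
  · rintro ⟨t, ht, s, hs, rfl⟩ l
    have := ht.1 l
    have := ht.2 l
    have := hs.1 l
    have := hs.2 l
    rw [Pi.sub_apply, abs_lt]
    omega
  · intro hh
    have bounds := fun l => abs_lt.1 (hh l)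
    refine ⟨fun l => max 1 (1 + h l), ⟨fun l => ?_, fun l => ?_⟩,
      fun l => max 1 (1 + h l) - h l, ⟨fun l => ?_, fun l => ?_⟩, funext fun l => ?_⟩ <;>
    · have := bounds l
      simp only [Pi.sub_apply]
      omega

theorem latticePt_add_single (h : Fin d → ℤ) (l : Fin d) (m : ℤ) :
    latticePt (h + Pi.single l m) = latticePt h + (m : ℝ) • EuclideanSpace.single l (1 : ℝ) := by
  ext j
  obtain rfl | hj := eq_or_ne j l <;> simp_all [latticePt]

theorem abs_coord_le_of_norm_smul_latticePt_le (hΔ : 0 < Δ) {R : ℝ}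
    (h_le : ‖Δ⁻¹ • latticePt h‖ ≤ R) (l : Fin d) : |(h l : ℝ)| ≤ R * Δ := by
  have coord := (PiLp.norm_apply_le (Δ⁻¹ • latticePt h) l).trans h_le
  rwa [PiLp.smul_apply, norm_smul, Real.norm_of_nonneg (inv_pos.2 hΔ).le, inv_mul_le_iff₀ hΔ,
    mul_comm] at coord

variable (hsupp : ∀ k : Fin d → ℤ, latticePt k ∈ Δ • kernelSupport K → k ∈ grid N - grid N)

include hsupp in
theorem kernel_eq_zero_of_notMem_lags (hK : IsKernel K) (hΔ : 0 < Δ) (hh : h ∉ grid N - grid N) :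
    K (Δ⁻¹ • latticePt h) = 0 := by
  refine (hK.nonneg _).antisymm' (not_lt.1 fun hpos => hh (hsupp h ?_))
  rwa [Set.mem_smul_set_iff_inv_smul_mem₀ hΔ.ne']

include hsupp in
theorem kernel_mul_bandwidth_le (hK : IsKernel K) (hΔ : 0 < Δ) {l : Fin d}
    (hKl : ∀ x, LineDifferentiableAt ℝ K x (EuclideanSpace.single l 1)) {B : ℝ}
    (hB : ∀ x, |lineDeriv ℝ K x (EuclideanSpace.single l 1)| ≤ B) (hh : |h l| ≤ N l) :
    K (Δ⁻¹ • latticePt h) * Δ ≤ B * (N l - |(h l : ℝ)|) := by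
  -- Shifting the `l`-th coordinate of `h` by `m` reaches the boundary, where the kernel vanishes.
  obtain ⟨m, abs_m, abs_add_m⟩ : ∃ m : ℤ, |m| = N l - |h l| ∧ |h l + m| = N l := by
    rcases le_total 0 (h l) with hs | hs
    · exact ⟨N l - |h l|, abs_of_nonneg (by linarith), by rw [abs_of_nonneg hs]; simp⟩
    · exact ⟨-(N l - |h l|), by rw [abs_neg, abs_of_nonneg (by linarith)],
        by rw [abs_of_nonpos hs]; simp⟩
  have boundary_zero : K (Δ⁻¹ • latticePt (h + Pi.single l m)) = 0 :=
    kernel_eq_zero_of_notMem_lags hsupp hK hΔ fun hmem => by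
      simpa [abs_add_m] using mem_grid_sub_grid.1 hmem l
  have increment := abs_add_smul_sub_le_of_lineDeriv_le hKl (Δ⁻¹ • latticePt h) (Δ⁻¹ * m)
    fun σ _ => hB _
  rw [mul_smul, ← smul_add, ← latticePt_add_single, boundary_zero, zero_sub, abs_neg,
    abs_of_nonneg (hK.nonneg _), abs_mul, abs_of_pos (inv_pos.2 hΔ), ← Int.cast_abs, abs_m]
    at increment
  calc K (Δ⁻¹ • latticePt h) * Δ ≤ B * (Δ⁻¹ * ((N l - |h l| : ℤ) : ℝ)) * Δ := by gcongr
    _ = B * (N l - |(h l : ℝ)|) := by push_cast; field_simp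

theorem exists_kernel_mul_le (hK : IsKernel K) {r : ℕ} (hKr : IsFlatToOrder K r) :
    ∃ C : ℝ, 0 ≤ C ∧ ∀ (N : Fin d → ℕ) (Δ : ℝ), 0 < Δ →
      (∀ k : Fin d → ℤ, latticePt k ∈ Δ • kernelSupport K → k ∈ grid N - grid N) →
      ∀ h ∈ grid N - grid N, ∀ l,
        K (Δ⁻¹ • latticePt h) * N l ≤ C * (N l - |(h l : ℝ)|) := by
  obtain ⟨R, hR0, hR⟩ := exists_radius hK
  obtain ⟨B, hB0, hB⟩ := exists_partial_bound hKr hR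
  refine ⟨1 + R * B, by positivity, fun N Δ hΔ hsupp h hh l => ?_⟩
  have abs_lt : |h l| < N l := mem_grid_sub_grid.1 hh l
  have gap_nonneg : 0 ≤ N l - |(h l : ℝ)| := sub_nonneg.2 (by exact_mod_cast abs_lt.le)
  have K_nonneg := hK.nonneg (Δ⁻¹ • latticePt h)
  have abs_le : K (Δ⁻¹ • latticePt h) * |(h l : ℝ)| ≤ K (Δ⁻¹ • latticePt h) * (R * Δ) := by
    rcases le_or_gt ‖Δ⁻¹ • latticePt h‖ R with h_in | h_out
    · gcongr
      exact abs_coord_le_of_norm_smul_latticePt_le hΔ h_in l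
    · simp [hR _ h_out]
  have bandwidth_le := kernel_mul_bandwidth_le hsupp hK hΔ
    (hKr.exists_partial [] (by simp) l) (hB l) abs_lt.le
  calc K (Δ⁻¹ • latticePt h) * N l
      = K (Δ⁻¹ • latticePt h) * (N l - |(h l : ℝ)|) + K (Δ⁻¹ • latticePt h) * |(h l : ℝ)| := by ring
    _ ≤ 1 * (N l - |(h l : ℝ)|) + R * (K (Δ⁻¹ • latticePt h) * Δ) :=
        add_le_add (by gcongr; exact hK.le_one _) (by linarith)
    _ ≤ 1 * (N l - |(h l : ℝ)|) + R * (B * (N l - |(h l : ℝ)|)) := by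
        gcongr
    _ = (1 + R * B) * (N l - |(h l : ℝ)|) := by ring

end Lags

/-! ### Sums over lags -/

section Overlap

variable {d : ℕ} {N : Fin d → ℕ} {h : Fin d → ℤ}

theorem min_add_sub_max_zero {α : Type*} [AddCommGroup α] [LinearOrder α] [IsOrderedAddMonoid α]
    (a x : α) : min a (a + x) - max 0 x = a - |x| := by
  rcases le_total 0 x with hx | hx
  · rw [min_eq_left (le_add_of_nonneg_right hx), max_eq_right hx, abs_of_nonneg hx]
  · rw [min_eq_right (add_le_of_nonpos_right hx), max_eq_left hx, abs_of_nonpos hx, sub_zero,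
      sub_neg_eq_add]

theorem region_inter_shift_eq_Icc (N : Fin d → ℕ) (h : Fin d → ℤ) :
    region N ∩ {x | x + (fun i => (h i : ℝ)) ∈ region N}
      = Set.Icc (fun i => max 0 (-(h i : ℝ))) (fun i => min (N i : ℝ) (N i + -h i)) := by
  ext x
  simp only [region, Set.mem_inter_iff, Set.mem_Icc, Set.mem_ofPred_eq, Pi.le_def, Pi.add_apply,
    Pi.zero_apply, max_le_iff, le_min_iff, forall_and, neg_le_iff_add_nonneg, le_add_neg_iff_add_le]
  tauto

theorem overlap_eq_prod (hh : ∀ l, |h l| ≤ N l) : overlap N h = ∏ l, ((N l : ℝ) - |(h l : ℝ)|) := by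
  have side (l : Fin d) :
      min (N l : ℝ) (N l + -h l) - max 0 (-(h l : ℝ)) = N l - |(h l : ℝ)| := by
    rw [min_add_sub_max_zero, abs_neg]
  have side_nonneg : ∀ l, 0 ≤ (N l : ℝ) - |(h l : ℝ)| := fun l =>
    sub_nonneg.2 (by exact_mod_cast hh l)
  rw [overlap, region_inter_shift_eq_Icc, Real.volume_Icc_pi_toReal]
  · exact Finset.prod_congr rfl fun l _ => side l
  · exact fun l => sub_nonneg.1 ((side_nonneg l).trans_eq (side l).symm)

theorem overlap_pos (hh : h ∈ grid N - grid N) : 0 < overlap N h := by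
  rw [mem_grid_sub_grid] at hh
  rw [overlap_eq_prod fun l => (hh l).le]
  exact Finset.prod_pos fun l _ => sub_pos.2 (by exact_mod_cast hh l)

theorem card_grid (N : Fin d → ℕ) : (grid N).card = ∏ l, N l := by
  rw [grid, Pi.card_Icc]
  simp

theorem card_pairs_with_lag (hh : ∀ l, |h l| ≤ N l) :
    (({p ∈ grid N ×ˢ grid N | p.1 - p.2 = h} : Finset _).card : ℝ) = overlap N h := by
  have pairs_eq : ({p ∈ grid N ×ˢ grid N | p.1 - p.2 = h} : Finset _)
      = (Finset.Icc (1 + fun l => max 0 (h l)) (fun l => min (N l : ℤ) (N l + h l))).image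
        fun t => (t, t - h) := by
    ext ⟨t, s⟩
    simp only [Finset.mem_filter, Finset.mem_product, grid, Finset.mem_Icc, Pi.le_def,
      Finset.mem_image, Prod.mk.injEq, Pi.one_apply, Pi.add_apply]
    constructor
    · rintro ⟨⟨⟨h1, h2⟩, h3, h4⟩, rfl⟩
      refine ⟨t, ⟨fun l => ?_, fun l => ?_⟩, rfl, by simp⟩ <;> grind [Pi.sub_apply]
    · rintro ⟨t, ⟨h1, h2⟩, rfl, rfl⟩
      refine ⟨⟨⟨fun l => ?_, fun l => ?_⟩, fun l => ?_, fun l => ?_⟩, sub_sub_cancel t h⟩ <;>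
        grind [Pi.sub_apply]
  rw [pairs_eq, Finset.card_image_of_injective _ fun _ _ eq => (Prod.ext_iff.1 eq).1,
    Pi.card_Icc, overlap_eq_prod hh, Nat.cast_prod]
  refine Finset.prod_congr rfl fun l _ => ?_
  have side := min_add_sub_max_zero (N l : ℤ) (h l)
  rw [Int.card_Icc, Pi.add_apply, Pi.one_apply,
    show min (N l : ℤ) (N l + h l) + 1 - (1 + max 0 (h l)) = N l - |h l| by linarith,
    ← Int.cast_natCast (R := ℝ), Int.toNat_of_nonneg (sub_nonneg.2 (hh l))]
  push_cast
  rfl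

theorem sum_grid_sub {E : Type*} [AddCommGroup E] [Module ℝ E] (N : Fin d → ℕ)
    (φ : (Fin d → ℤ) → E) :
    ∑ t ∈ grid N, ∑ s ∈ grid N, φ (t - s) = ∑ h ∈ grid N - grid N, overlap N h • φ h := by
  rw [← Finset.sum_product', ← Finset.sum_fiberwise_of_maps_to
    (t := grid N - grid N) (g := fun p : (Fin d → ℤ) × (Fin d → ℤ) => p.1 - p.2)]
  · refine Finset.sum_congr rfl fun h hh => ?_
    rw [← card_pairs_with_lag fun l => (mem_grid_sub_grid.1 hh l).le, Nat.cast_smul_eq_nsmul,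
      ← Finset.sum_const]
    exact Finset.sum_congr rfl fun p hp => by rw [(Finset.mem_filter.1 hp).2]
  · rintro ⟨t, s⟩ hp
    rw [Finset.mem_product] at hp
    exact Finset.sub_mem_sub hp.1 hp.2

end Overlap

section PowerSum

variable {γ : ℝ}

theorem mul_rpow_sub_one_le_rpow_sub (hγ : 0 ≤ γ) (hγ1 : γ ≤ 1) {a : ℝ} (ha : 1 ≤ a) :
    γ * a ^ (γ - 1) ≤ a ^ γ - (a - 1) ^ γ := by
  have ha0 : 0 < a := by linarith
  have inv_le : a⁻¹ ≤ 1 := inv_le_one_of_one_le₀ ha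
  have bernoulli := rpow_one_add_le_one_add_mul_self (s := -a⁻¹) (by linarith) hγ hγ1
  have : (a - 1) ^ γ ≤ a ^ γ - γ * a ^ (γ - 1) := calc
    (a - 1) ^ γ = a ^ γ * (1 + -a⁻¹) ^ γ := by
      rw [← Real.mul_rpow ha0.le (by linarith)]
      congr 1
      field_simp
      ring
    _ ≤ a ^ γ * (1 + γ * -a⁻¹) := by gcongr
    _ = a ^ γ - γ * a ^ (γ - 1) := by rw [Real.rpow_sub_one ha0.ne']; ring
  linarith

theorem rpow_sub_rpow_sub_le (hγ1 : γ ≤ 1) {a b : ℝ} (hb : 0 ≤ b) (hba : b < a) :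
    a ^ γ - (a - b) ^ γ ≤ b * a ^ (γ - 1) := by
  have ha0 : 0 < a := hb.trans_lt hba
  have ratio_pos : 0 < (a - b) / a := div_pos (sub_pos.2 hba) ha0
  have ratio_le : (a - b) / a ≤ 1 := (div_le_one ha0).2 (by linarith)
  have : a ^ γ - b * a ^ (γ - 1) ≤ (a - b) ^ γ := calc
    a ^ γ - b * a ^ (γ - 1) = a ^ γ * ((a - b) / a) := by
      rw [Real.rpow_sub_one ha0.ne']
      field_simp
    _ ≤ a ^ γ * ((a - b) / a) ^ γ := by
      gcongr
      simpa using Real.rpow_le_rpow_of_exponent_ge ratio_pos ratio_le hγ1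
    _ = (a - b) ^ γ := by
      rw [← Real.mul_rpow ha0.le ratio_pos.le, mul_div_cancel₀ _ ha0.ne']
  linarith

theorem sum_range_sub_rpow_sub_one_le (hγ : 0 < γ) (hγ1 : γ ≤ 1) {m n : ℕ} (hmn : m ≤ n) :
    ∑ j ∈ Finset.range m, ((n : ℝ) - j) ^ (γ - 1) ≤ m * (n : ℝ) ^ (γ - 1) / γ := by
  rw [le_div_iff₀' hγ, Finset.mul_sum]
  calc ∑ j ∈ Finset.range m, γ * ((n : ℝ) - j) ^ (γ - 1)
      ≤ ∑ j ∈ Finset.range m, (((n : ℝ) - j) ^ γ - ((n : ℝ) - (j + 1 : ℕ)) ^ γ) := by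
        refine Finset.sum_le_sum fun j hj => ?_
        have : (j : ℝ) + 1 ≤ n := by exact_mod_cast (Finset.mem_range.1 hj).trans_le hmn
        rw [Nat.cast_add_one, ← sub_sub]
        exact mul_rpow_sub_one_le_rpow_sub hγ.le hγ1 (by linarith)
    _ = (n : ℝ) ^ γ - ((n : ℝ) - m) ^ γ := by
        rw [Finset.sum_range_sub' fun j : ℕ => ((n : ℝ) - j) ^ γ, Nat.cast_zero, sub_zero]
    _ ≤ m * (n : ℝ) ^ (γ - 1) := by
        rcases hmn.eq_or_lt with rfl | hlt
        · rcases m.eq_zero_or_pos with rfl | hm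
          · simp
          · rw [sub_self, Real.zero_rpow hγ.ne', sub_zero, Real.rpow_sub_one (by positivity),
              mul_div_cancel₀ _ (by positivity)]
        · exact rpow_sub_rpow_sub_le hγ1 m.cast_nonneg (by exact_mod_cast hlt)

theorem sum_Icc_sub_abs_rpow_sub_one_le (hγ : 0 < γ) (hγ1 : γ ≤ 1) {m n : ℕ} (hmn : m < n) :
    ∑ j ∈ Finset.Icc (-m : ℤ) m, ((n : ℝ) - |(j : ℝ)|) ^ (γ - 1)
      ≤ 2 * ((m + 1) * (n : ℝ) ^ (γ - 1) / γ) := by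
  have even : Function.Even fun j : ℤ => ((n : ℝ) - |(j : ℝ)|) ^ (γ - 1) := fun j => by
    simp only [Int.cast_neg, abs_neg]
  rw [Finset.sum_Icc_of_even_eq_range even, nsmul_eq_mul, Nat.cast_ofNat]
  refine (sub_le_self _ (by simp only [Int.cast_zero, abs_zero, sub_zero]; positivity)).trans ?_
  gcongr
  simpa using sum_range_sub_rpow_sub_one_le hγ hγ1 (Nat.succ_le_of_lt hmn)

theorem sq_div_prod_le_prod_rpow {κ : Type*} [Fintype κ] [Nonempty κ] {x : ℝ} (hx : 0 ≤ x)
    (hx1 : x ≤ 1) {a c : κ → ℝ} (ha : ∀ l, 0 < a l) (hc : ∀ l, 0 ≤ c l) (h : ∀ l, x ≤ c l * a l) :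
    x ^ 2 / ∏ l, a l
      ≤ ∏ l, c l ^ (Fintype.card κ : ℝ)⁻¹ * a l ^ ((Fintype.card κ : ℝ)⁻¹ - 1) := by
  set γ := (Fintype.card κ : ℝ)⁻¹
  calc x ^ 2 / ∏ l, a l ≤ x / ∏ l, a l := by
        have := Finset.prod_nonneg fun l (_ : l ∈ Finset.univ) => (ha l).le
        gcongr
        exact pow_le_of_le_one hx hx1 two_ne_zero
    _ = (∏ _l : κ, x ^ γ) / ∏ l, a l := by
        rw [Finset.prod_const, Finset.card_univ, Real.rpow_inv_natCast_pow hx Fintype.card_ne_zero]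
    _ = ∏ l, x ^ γ / a l := by rw [Finset.prod_div_distrib]
    _ ≤ ∏ l, (c l * a l) ^ γ / a l := by
        gcongr with l
        · exact fun l _ => div_nonneg (Real.rpow_nonneg hx γ) (ha l).le
        · exact (ha l).le
        · exact h l
    _ = ∏ l, c l ^ γ * a l ^ (γ - 1) := Finset.prod_congr rfl fun l _ => by
        rw [Real.mul_rpow (hc l) (ha l).le, Real.rpow_sub_one (ha l).ne', mul_div_assoc]

end PowerSum

section Box

variable {d : ℕ} {K : EuclideanSpace ℝ (Fin d) → ℝ} {N : Fin d → ℕ} {Δ : ℝ}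

/-- The lags of the sampling grid whose coordinates are at most `ρ` in absolute value. -/
def lagBox (N : Fin d → ℕ) (ρ : ℝ) : Finset (Fin d → ℤ) :=
  Fintype.piFinset fun l => Finset.Icc (-(min (N l - 1) ⌊ρ⌋₊ : ℕ) : ℤ) (min (N l - 1) ⌊ρ⌋₊ : ℕ)

theorem mem_lagBox {ρ : ℝ} (hρ : 0 ≤ ρ) (hN : ∀ l, 1 ≤ N l) {h : Fin d → ℤ} :
    h ∈ lagBox N ρ ↔ h ∈ grid N - grid N ∧ ∀ l, |(h l : ℝ)| ≤ ρ := by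
  simp only [lagBox, Fintype.mem_piFinset, Finset.mem_Icc, ← abs_le, mem_grid_sub_grid,
    ← forall_and]
  refine forall_congr' fun l => ?_
  have abs_lt_iff : |h l| < N l ↔ (h l).natAbs ≤ N l - 1 := by
    have := hN l
    rw [Int.abs_eq_natAbs]
    omega
  rw [abs_lt_iff, ← Int.cast_abs, ← Nat.cast_natAbs, ← Nat.le_floor_iff hρ, ← le_min_iff,
    Int.abs_eq_natAbs, Nat.cast_le]

theorem sum_lagBox_prod_rpow_le {γ C ρ : ℝ} (hγ : 0 < γ) (hγ1 : γ ≤ 1) (hC : 0 ≤ C) (hρ : 0 ≤ ρ)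
    (hN : ∀ l, 1 ≤ N l) :
    ∑ h ∈ lagBox N ρ, ∏ l, (C / N l) ^ γ * ((N l : ℝ) - |(h l : ℝ)|) ^ (γ - 1)
      ≤ (2 * C ^ γ * (ρ + 1) / γ) ^ d / (grid N).card := by
  rw [lagBox, ← Finset.prod_univ_sum _ fun l (j : ℤ) =>
    (C / N l) ^ γ * ((N l : ℝ) - |(j : ℝ)|) ^ (γ - 1), card_grid, Nat.cast_prod,
    ← Fin.prod_const, ← Finset.prod_div_distrib]
  have min_lt : ∀ l, min (N l - 1) ⌊ρ⌋₊ < N l := fun l =>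
    (min_le_left _ _).trans_lt (Nat.sub_one_lt_of_lt (hN l))
  refine Finset.prod_le_prod (fun l _ => Finset.sum_nonneg fun j hj => ?_) fun l _ => ?_
  · have : |(j : ℝ)| ≤ N l := by
      exact_mod_cast (abs_le.2 (Finset.mem_Icc.1 hj)).trans (Nat.cast_le.2 (min_lt l).le)
    have := sub_nonneg.2 this
    positivity
  · have N_pos : (0 : ℝ) < N l := by exact_mod_cast hN l
    have min_le : ((min (N l - 1) ⌊ρ⌋₊ : ℕ) : ℝ) ≤ ρ :=
      (Nat.cast_le.2 (min_le_right _ _)).trans (Nat.floor_le hρ)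
    rw [← Finset.mul_sum]
    calc (C / N l) ^ γ * ∑ j ∈ (_ : Finset ℤ), ((N l : ℝ) - |(j : ℝ)|) ^ (γ - 1)
        ≤ (C / N l) ^ γ * (2 * ((ρ + 1) * (N l : ℝ) ^ (γ - 1) / γ)) := by
          refine mul_le_mul_of_nonneg_left ?_ (by positivity)
          refine (sum_Icc_sub_abs_rpow_sub_one_le hγ hγ1 (min_lt l)).trans ?_
          gcongr
      _ = 2 * C ^ γ * (ρ + 1) / γ / N l := by
          rw [Real.div_rpow hC N_pos.le, Real.rpow_sub_one N_pos.ne']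
          field_simp

theorem exists_sum_sq_div_overlap_le (hd : 1 ≤ d) (hK : IsKernel K) {r : ℕ}
    (hKr : IsFlatToOrder K r) :
    ∃ C : ℝ, 0 ≤ C ∧ ∀ (N : Fin d → ℕ) (Δ : ℝ), 1 ≤ Δ → (∀ l, 1 ≤ N l) →
      (∀ k, latticePt k ∈ Δ • kernelSupport K → k ∈ grid N - grid N) →
        ∑ h ∈ grid N - grid N, K (Δ⁻¹ • latticePt h) ^ 2 / overlap N h
          ≤ C * (Δ ^ d / (grid N).card) := by
  obtain ⟨R, R_nonneg, zero_outside⟩ := exists_radius hK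
  obtain ⟨C, C_nonneg, kernel_mul_le⟩ := exists_kernel_mul_le hK hKr
  have : Nonempty (Fin d) := ⟨⟨0, hd⟩⟩
  set γ : ℝ := (d : ℝ)⁻¹
  have γ_pos : 0 < γ := inv_pos.2 (by exact_mod_cast hd)
  have γ_le : γ ≤ 1 := inv_le_one_of_one_le₀ (by exact_mod_cast hd)
  refine ⟨(2 * C ^ γ * (R + 1) / γ) ^ d, by positivity, fun N Δ hΔ hN hsupp => ?_⟩
  have Δ_pos : 0 < Δ := one_pos.trans_le hΔ
  have mem_box {h} := mem_lagBox (h := h) (mul_nonneg R_nonneg Δ_pos.le) hN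
  calc ∑ h ∈ grid N - grid N, K (Δ⁻¹ • latticePt h) ^ 2 / overlap N h
      = ∑ h ∈ lagBox N (R * Δ), K (Δ⁻¹ • latticePt h) ^ 2 / overlap N h := by
        refine (Finset.sum_subset (fun h hh => (mem_box.1 hh).1) fun h hh hbox => ?_).symm
        rw [zero_outside _ ?_, zero_pow two_ne_zero, zero_div]
        by_contra! hle
        exact hbox (mem_box.2 ⟨hh, abs_coord_le_of_norm_smul_latticePt_le Δ_pos hle⟩)
    _ ≤ ∑ h ∈ lagBox N (R * Δ), ∏ l, (C / N l) ^ γ * ((N l : ℝ) - |(h l : ℝ)|) ^ (γ - 1) := by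
        refine Finset.sum_le_sum fun h hh => ?_
        have hlag := (mem_box.1 hh).1
        have h_lt := mem_grid_sub_grid.1 hlag
        rw [overlap_eq_prod fun l => (h_lt l).le]
        simpa only [Fintype.card_fin] using sq_div_prod_le_prod_rpow (hK.nonneg _) (hK.le_one _)
          (fun l => sub_pos.2 (by exact_mod_cast h_lt l)) (fun l => by positivity)
          fun l => (le_div_iff₀ (by exact_mod_cast hN l)).2
            (kernel_mul_le N Δ Δ_pos hsupp h hlag l) |>.trans_eq (mul_div_right_comm ..)
    _ ≤ (2 * C ^ γ * (R * Δ + 1) / γ) ^ d / (grid N).card :=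
        sum_lagBox_prod_rpow_le γ_pos γ_le C_nonneg (mul_nonneg R_nonneg Δ_pos.le) hN
    _ ≤ (2 * C ^ γ * ((R + 1) * Δ) / γ) ^ d / (grid N).card := by
        have : R * Δ + 1 ≤ (R + 1) * Δ := by linarith
        gcongr
    _ = (2 * C ^ γ * (R + 1) / γ) ^ d * (Δ ^ d / (grid N).card) := by
        rw [← mul_div_assoc, ← mul_pow]
        ring_nf

end Box

/-! ### Second moments of random vectors -/

section SchurTest

variable {V : Type*} [NormedAddCommGroup V] [InnerProductSpace ℂ V]

theorem two_mul_mul_le_sq_add_sq (a b : ℝ≥0∞) : 2 * (a * b) ≤ a ^ 2 + b ^ 2 := by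
  have young := ENNReal.young_inequality a b Real.HolderConjugate.two_two
  rw [ENNReal.rpow_two, ENNReal.rpow_two, ENNReal.ofReal_ofNat, ← ENNReal.add_div] at young
  rw [mul_comm]
  exact ENNReal.mul_le_of_le_div young

theorem enorm_sq_sum_smul_le {κ : Type*} (s : Finset κ) (z : κ → V) (c : κ → ℂ) {Λ : ℝ≥0∞}
    (hΛ : ∀ i ∈ s, ∑ j ∈ s, ‖inner ℂ (z j) (z i)‖ₑ ≤ Λ) :
    ‖∑ i ∈ s, c i • z i‖ₑ ^ 2 ≤ Λ * ∑ i ∈ s, ‖c i‖ₑ ^ 2 := by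
  have double_sum : ‖∑ i ∈ s, c i • z i‖ₑ ^ 2
      ≤ ∑ i ∈ s, ∑ j ∈ s, ‖c i‖ₑ * ‖c j‖ₑ * ‖inner ℂ (z j) (z i)‖ₑ := by
    have norm_sq : ‖∑ i ∈ s, c i • z i‖ₑ ^ 2
        = ‖inner ℂ (∑ j ∈ s, c j • z j) (∑ i ∈ s, c i • z i)‖ₑ := by
      simp [inner_self_eq_norm_sq_to_K, ← ofReal_norm]
    rw [norm_sq, inner_sum]
    refine (enorm_sum_le _ _).trans (Finset.sum_le_sum fun i _ => ?_)
    rw [sum_inner]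
    refine (enorm_sum_le _ _).trans_eq (Finset.sum_congr rfl fun j _ => ?_)
    rw [inner_smul_left, inner_smul_right, enorm_mul, enorm_mul, RCLike.enorm_conj]
    ring
  have diagonal : ∑ i ∈ s, ∑ j ∈ s, ‖c i‖ₑ ^ 2 * ‖inner ℂ (z j) (z i)‖ₑ
      ≤ Λ * ∑ i ∈ s, ‖c i‖ₑ ^ 2 := by
    rw [Finset.mul_sum]
    refine Finset.sum_le_sum fun i hi => ?_
    rw [← Finset.mul_sum, mul_comm]
    gcongr
    exact hΛ i hi
  have enorm_inner_comm : ∀ x y : V, ‖inner ℂ x y‖ₑ = ‖inner ℂ y x‖ₑ := fun x y => by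
    rw [← inner_conj_symm, RCLike.enorm_conj]
  refine (ENNReal.mul_le_mul_iff_right two_ne_zero ENNReal.ofNat_ne_top).1 ?_
  calc 2 * ‖∑ i ∈ s, c i • z i‖ₑ ^ 2
      ≤ ∑ i ∈ s, ∑ j ∈ s, 2 * (‖c i‖ₑ * ‖c j‖ₑ) * ‖inner ℂ (z j) (z i)‖ₑ := by
        simpa only [Finset.mul_sum, mul_assoc] using mul_le_mul_right double_sum 2
    _ ≤ ∑ i ∈ s, ∑ j ∈ s, (‖c i‖ₑ ^ 2 + ‖c j‖ₑ ^ 2) * ‖inner ℂ (z j) (z i)‖ₑ := by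
        gcongr
        exact two_mul_mul_le_sq_add_sq _ _
    _ = 2 * ∑ i ∈ s, ∑ j ∈ s, ‖c i‖ₑ ^ 2 * ‖inner ℂ (z j) (z i)‖ₑ := by
        simp only [add_mul, Finset.sum_add_distrib, two_mul]
        congr 1
        rw [Finset.sum_comm]
        simp only [enorm_inner_comm]
    _ ≤ 2 * (Λ * ∑ i ∈ s, ‖c i‖ₑ ^ 2) := by gcongr

end SchurTest

section ScalarCovariance

variable {V : Type*} [NormedAddCommGroup V]
variable {Ω : Type*} [MeasurableSpace Ω] {P : Measure Ω}

theorem lintegral_enorm_sq (f : Ω → V) : ∫⁻ ω, ‖f ω‖ₑ ^ 2 ∂P = eLpNorm f 2 P ^ 2 := by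
  simpa using (eLpNorm_nnreal_pow_eq_lintegral (p := 2) two_ne_zero).symm

variable [InnerProductSpace ℂ V]

/-- The scalar covariance `E⟨Y - EY, Z - EZ⟩` of two random vectors. -/
def scalarCov (P : Measure Ω) (Y Z : Ω → V) : ℂ :=
  ∫ ω, inner ℂ (Y ω - ∫ ω', Y ω' ∂P) (Z ω - ∫ ω', Z ω' ∂P) ∂P

theorem isBoundedBilinearMap_sesquilinear {E F G : Type*} [NormedAddCommGroup E]
    [NormedSpace ℂ E] [NormedAddCommGroup F] [NormedSpace ℂ F] [NormedAddCommGroup G]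
    [NormedSpace ℂ G] (f : E →L[ℂ] F →L⋆[ℂ] G) :
    IsBoundedBilinearMap ℝ fun p : E × F => f p.1 p.2 where
  add_left x x' y := by simp only [map_add, add_apply]
  smul_left c x y := by
    rw [← Complex.coe_smul, map_smul]
    rfl
  add_right x := map_add (f x)
  smul_right c x y := by
    rw [← Complex.coe_smul, map_smulₛₗ, Complex.conj_ofReal]
    rfl
  bound := ⟨‖f‖ + 1, by positivity, fun x y => (f.le_opNorm₂ x y).trans (by gcongr; linarith)⟩

theorem memLp_sesquilinear {E F G : Type*} [NormedAddCommGroup E]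
    [NormedSpace ℂ E] [NormedAddCommGroup F] [NormedSpace ℂ F] [NormedAddCommGroup G]
    [NormedSpace ℂ G] (f : E →L[ℂ] F →L⋆[ℂ] G) {p q r : ℝ≥0∞} [ENNReal.HolderTriple p q r]
    {Y : Ω → E} {Z : Ω → F} (hY : MemLp Y p P) (hZ : MemLp Z q P) :
    MemLp (fun ω => f (Y ω) (Z ω)) r P :=
  .of_bilin (fun x y => f x y) ‖f‖₊ hY hZ
    ((isBoundedBilinearMap_sesquilinear f).continuous.comp_aestronglyMeasurable (hY.1.prodMk hZ.1))
    (.of_forall fun ω => f.le_opNorm₂ (Y ω) (Z ω))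

theorem lintegral_enorm_sq_sum_smul_sub_le [IsFiniteMeasure P] {κ : Type*} (s : Finset κ)
    {W : κ → Ω → V} (c : κ → ℂ) {Λ : ℝ≥0∞} (hW : ∀ i, MemLp (W i) 2 P)
    (hΛ : ∀ i ∈ s, ∑ j ∈ s, ‖scalarCov P (W j) (W i)‖ₑ ≤ Λ) :
    ∫⁻ ω, ‖∑ i ∈ s, c i • (W i ω - ∫ ω', W i ω' ∂P)‖ₑ ^ 2 ∂P ≤ Λ * ∑ i ∈ s, ‖c i‖ₑ ^ 2 := by
  have centred (i : κ) : MemLp (fun ω => W i ω - ∫ ω', W i ω' ∂P) 2 P :=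
    (hW i).sub (memLp_const _)
  have inner_eq_scalarCov (i j : κ) :
      inner ℂ (centred j).toLp (centred i).toLp = scalarCov P (W j) (W i) := by
    rw [L2.inner_def]
    refine integral_congr_ae ?_
    filter_upwards [(centred i).coeFn_toLp, (centred j).coeFn_toLp] with ω hi hj
    rw [hi, hj]
  have coeFn_sum : (∑ i ∈ s, c i • (centred i).toLp : Lp V 2 P)
      =ᵐ[P] fun ω => ∑ i ∈ s, c i • (W i ω - ∫ ω', W i ω' ∂P) := by
    have coeFn_smul : ∀ i ∈ s, ∀ᵐ ω ∂P, (c i • (centred i).toLp : Lp V 2 P) ω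
        = c i • (W i ω - ∫ ω', W i ω' ∂P) := fun i _ => by
      filter_upwards [Lp.coeFn_smul (c i) (centred i).toLp, (centred i).coeFn_toLp] with ω h₁ h₂
      rw [h₁, Pi.smul_apply, h₂]
    filter_upwards [Lp.coeFn_fun_finsetSum s fun i => c i • (centred i).toLp,
      (Finset.eventually_all s).2 coeFn_smul] with ω h₁ h₂
    rw [h₁, Finset.sum_congr rfl h₂]
  have lintegral_eq := lintegral_congr_ae (coeFn_sum.fun_comp fun x => ‖x‖ₑ ^ 2)
  simp only [Function.comp_def] at lintegral_eq
  rw [← lintegral_eq, lintegral_enorm_sq, ← Lp.enorm_def]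
  refine enorm_sq_sum_smul_le s _ c fun i hi => ?_
  simpa only [inner_eq_scalarCov] using hΛ i hi

variable {Y Z : Ω → V}

theorem integrable_inner_of_memLp_two (hY : MemLp Y 2 P) (hZ : MemLp Z 2 P) :
    Integrable (fun ω => inner ℂ (Y ω) (Z ω)) P :=
  memLp_one_iff_integrable.1 (memLp_sesquilinear (innerSL ℂ).flip hZ hY)

variable [IsProbabilityMeasure P] [CompleteSpace V]

theorem scalarCov_eq_sub (hY : MemLp Y 2 P) (hZ : MemLp Z 2 P) :
    scalarCov P Y Z
      = ∫ ω, inner ℂ (Y ω) (Z ω) ∂P - inner ℂ (∫ ω, Y ω ∂P) (∫ ω, Z ω ∂P) := by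
  have integrable_Y := hY.integrable one_le_two
  have integrable_Z := hZ.integrable one_le_two
  set y := ∫ ω, Y ω ∂P
  set z := ∫ ω, Z ω ∂P
  have centred : ∫ ω, inner ℂ (Y ω - y) z ∂P = 0 := by
    have mean_zero : ∫ ω, (Y ω - y) ∂P = 0 := by
      rw [integral_sub integrable_Y (integrable_const y), integral_const, probReal_univ, one_smul,
        sub_self]
    have := integral_inner (𝕜 := ℂ) (integrable_Y.sub (integrable_const y)) z
    simp only [Pi.sub_apply, mean_zero, inner_zero_right] at this
    simpa only [← integral_conj, inner_conj_symm, map_zero] using congrArg (starRingEnd ℂ) this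
  have centred_integrable : MemLp (fun ω => Y ω - y) 2 P := hY.sub (memLp_const y)
  calc scalarCov P Y Z
      = ∫ ω, (inner ℂ (Y ω - y) (Z ω) - inner ℂ (Y ω - y) z) ∂P := by
        simp only [scalarCov, inner_sub_right]; rfl
    _ = ∫ ω, (inner ℂ (Y ω) (Z ω) - inner ℂ y (Z ω)) ∂P := by
        rw [integral_sub (integrable_inner_of_memLp_two centred_integrable hZ)
          (integrable_inner_of_memLp_two centred_integrable (memLp_const z)), centred, sub_zero]
        simp only [inner_sub_left]
    _ = ∫ ω, inner ℂ (Y ω) (Z ω) ∂P - inner ℂ y z := by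
        rw [integral_sub (integrable_inner_of_memLp_two hY hZ) (integrable_Z.const_inner y),
          integral_inner integrable_Z]

end ScalarCovariance

/-! ### Covariance operators and fourth-order cumulants -/

section CovarianceOperators

open InnerProductSpace (rankOne)

variable {H : Type*} [NormedAddCommGroup H] [InnerProductSpace ℂ H]
variable {Ω : Type*} [MeasurableSpace Ω] {P : Measure Ω} {Y Z : Ω → H}

theorem integrable_rankOne (hY : MemLp Y 2 P) (hZ : MemLp Z 2 P) :
    Integrable (fun ω => rankOne ℂ (Y ω) (Z ω)) P :=
  memLp_one_iff_integrable.1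
    (memLp_sesquilinear (rankOne ℂ : H →L[ℂ] H →L⋆[ℂ] H →L[ℂ] H) hY hZ)

variable {ι : Type*} (e : HilbertBasis ι ℂ H)

theorem integrable_hsRankOne (hY : MemLp Y 2 P) (hZ : MemLp Z 2 P) :
    Integrable (fun ω => hsRankOne e (Y ω) (Z ω)) P :=
  memLp_one_iff_integrable.1 (memLp_sesquilinear (hsRankOne e) hY hZ)

theorem memLp_two_hsRankOne (hY : MemLp Y 4 P) (hZ : MemLp Z 4 P) :
    MemLp (fun ω => hsRankOne e (Y ω) (Z ω)) 2 P :=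
  have : ENNReal.HolderTriple 4 4 2 := ⟨by
    rw [← two_mul, show (4 : ℝ≥0∞) = 2 * 2 by norm_num,
      ENNReal.mul_inv (.inl two_ne_zero) (.inl ENNReal.ofNat_ne_top), ← mul_assoc,
      ENNReal.mul_inv_cancel two_ne_zero ENNReal.ofNat_ne_top, one_mul]⟩
  memLp_sesquilinear (hsRankOne e) hY hZ

theorem covOp_apply [CompleteSpace H] (hY : MemLp Y 2 P) (hZ : MemLp Z 2 P) (x : H) :
    covOp P Y Z x = ∫ ω, rankOne ℂ (Y ω) (Z ω) x ∂P :=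
  ContinuousLinearMap.integral_apply (integrable_rankOne hY hZ) x

variable [CompleteSpace H]

theorem representsHS_covOp (hY : MemLp Y 2 P) (hZ : MemLp Z 2 P) :
    RepresentsHS e (covOp P Y Z) (∫ ω, hsRankOne e (Y ω) (Z ω) ∂P) := fun j => by
  rw [covOp_apply hY hZ]
  exact ((lp.evalCLM ℂ (fun _ : ι => H) 2 j).integral_comp_comm (integrable_hsRankOne e hY hZ)).symm

theorem enorm_integral_inner_le_traceNorm [TopologicalSpace.SeparableSpace H]
    (hY : MemLp Y 2 P) (hZ : MemLp Z 2 P) :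
    ‖∫ ω, inner ℂ (Y ω) (Z ω) ∂P‖ₑ ≤ traceNorm e (covOp P Z Y) := by
  have := countable_of_hilbertBasis e
  have integrable_term (j : ι) :
      AEStronglyMeasurable (fun ω => inner ℂ (Y ω) (e j) * inner ℂ (e j) (Z ω)) P :=
    (hY.1.inner aestronglyMeasurable_const).mul (aestronglyMeasurable_const.inner hZ.1)
  have dominated : ∑' j, ∫⁻ ω, ‖inner ℂ (Y ω) (e j) * inner ℂ (e j) (Z ω)‖ₑ ∂P ≠ ∞ := by
    have pointwise (ω : Ω) : ∑' j, ‖inner ℂ (Y ω) (e j) * inner ℂ (e j) (Z ω)‖ₑ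
        ≤ ‖Y ω‖ₑ ^ 2 + ‖Z ω‖ₑ ^ 2 := by
      rw [← tsum_enorm_inner_sq e (Y ω), ← tsum_enorm_inner_sq e (Z ω), ← ENNReal.tsum_add]
      refine ENNReal.tsum_le_tsum fun j => ?_
      rw [enorm_mul, ← inner_conj_symm, RCLike.enorm_conj]
      exact (le_mul_of_one_le_left' one_le_two).trans (two_mul_mul_le_sq_add_sq _ _)
    rw [← lintegral_tsum fun j => (integrable_term j).enorm]
    refine ne_top_of_le_ne_top ?_ (lintegral_mono pointwise)
    rw [lintegral_add_left' (hY.1.enorm.pow_const 2), lintegral_enorm_sq, lintegral_enorm_sq]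
    have := hY.2.ne
    have := hZ.2.ne
    finiteness
  have integral_term (j : ι) : ∫ ω, inner ℂ (Y ω) (e j) * inner ℂ (e j) (Z ω) ∂P
      = inner ℂ (e j) (covOp P Z Y (e j)) := by
    rw [covOp_apply hZ hY, ← integral_inner]
    · simp only [InnerProductSpace.rankOne_apply, inner_smul_right]
    · exact (integrable_rankOne hZ hY).apply_continuousLinearMap _
  calc ‖∫ ω, inner ℂ (Y ω) (Z ω) ∂P‖ₑ
      = ‖∑' j, inner ℂ (e j) (covOp P Z Y (e j))‖ₑ := by
        rw [← tsum_congr integral_term, ← integral_tsum integrable_term dominated]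
        simp only [e.tsum_inner_mul_inner]
    _ ≤ ∑' j, ‖inner ℂ (e j) (covOp P Z Y (e j))‖ₑ := enorm_tsum_le_tsum_enorm
    _ ≤ traceNorm e (covOp P Z Y) := tsum_enorm_inner_le_traceNorm e _

theorem enorm_hsInner_le_traceNorm_mul (A B : H →L[ℂ] H) :
    ‖hsInner e A B‖ₑ ≤ traceNorm e A * traceNorm e B :=
  calc ‖hsInner e A B‖ₑ
      ≤ ∑' j, ‖inner ℂ (A (e j)) (B (e j))‖ₑ := enorm_tsum_le_tsum_enorm
    _ ≤ hsNorm e A * hsNorm e B := tsum_enorm_inner_le_hsNorm_mul e A B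
    _ ≤ traceNorm e A * traceNorm e B :=
        mul_le_mul' (hsNorm_le_traceNorm e A) (hsNorm_le_traceNorm e B)

end CovarianceOperators

section Cumulants

open InnerProductSpace (rankOne)

variable {H : Type*} [NormedAddCommGroup H] [InnerProductSpace ℂ H] [CompleteSpace H]
variable {ι : Type*} {e : HilbertBasis ι ℂ H}
variable {Ω : Type*} [MeasurableSpace Ω] {P : Measure Ω}
variable [IsProbabilityMeasure P] {Y Z Y' Z' : Ω → H}

theorem scalarCov_hsRankOne_eq (hY : MemLp Y 4 P) (hZ : MemLp Z 4 P) (hY' : MemLp Y' 4 P)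
    (hZ' : MemLp Z' 4 P) (real_Z : ∀ᵐ ω ∂P, conjVec e (Z ω) = Z ω)
    (real_Z' : ∀ᵐ ω ∂P, conjVec e (Z' ω) = Z' ω) :
    scalarCov P (fun ω => hsRankOne e (Y ω) (Z ω)) (fun ω => hsRankOne e (Y' ω) (Z' ω))
      = cum4 e P Y Z Y' Z' + (∫ ω, inner ℂ (Y ω) (Y' ω) ∂P) * (∫ ω, inner ℂ (Z' ω) (Z ω) ∂P)
        + hsInner e (covOp P Y Z') (covOp P Y' Z) := by
  have covOp_congr {W : Ω → H} (V : Ω → H) (hW : ∀ᵐ ω ∂P, conjVec e (W ω) = W ω) :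
      covOp P V (fun ω => conjVec e (W ω)) = covOp P V W :=
    integral_congr_ae <| hW.mono fun ω h => by simp only [h]
  have memLp_two {W : Ω → H} (hW : MemLp W 4 P) : MemLp W 2 P := hW.mono_exponent (by norm_num)
  have product_means := (representsHS_covOp e (memLp_two hY) (memLp_two hZ)).hsInner_eq
    (representsHS_covOp e (memLp_two hY') (memLp_two hZ'))
  have scalarCov_eq : scalarCov P (fun ω => hsRankOne e (Y ω) (Z ω))
        (fun ω => hsRankOne e (Y' ω) (Z' ω))
      = ∫ ω, hsInner e (rankOne ℂ (Y ω) (Z ω)) (rankOne ℂ (Y' ω) (Z' ω)) ∂P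
        - hsInner e (covOp P Y Z) (covOp P Y' Z') := by
    simp only [(representsHS_hsRankOne e _ _).hsInner_eq (representsHS_hsRankOne e _ _)]
    refine (scalarCov_eq_sub (memLp_two_hsRankOne e hY hZ)
      (memLp_two_hsRankOne e hY' hZ')).trans ?_
    exact congrArg₂ (· - ·) rfl product_means.symm
  rw [scalarCov_eq, cum4, covOp_congr Y real_Z', covOp_congr Y' real_Z]
  ring

theorem enorm_scalarCov_hsRankOne_le [TopologicalSpace.SeparableSpace H]
    (hY : MemLp Y 4 P) (hZ : MemLp Z 4 P) (hY' : MemLp Y' 4 P)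
    (hZ' : MemLp Z' 4 P) (real_Z : ∀ᵐ ω ∂P, conjVec e (Z ω) = Z ω)
    (real_Z' : ∀ᵐ ω ∂P, conjVec e (Z' ω) = Z' ω) :
    ‖scalarCov P (fun ω => hsRankOne e (Y ω) (Z ω)) (fun ω => hsRankOne e (Y' ω) (Z' ω))‖ₑ
      ≤ ‖cum4 e P Y Z Y' Z'‖ₑ + traceNorm e (covOp P Y' Y) * traceNorm e (covOp P Z Z')
        + traceNorm e (covOp P Y Z') * traceNorm e (covOp P Y' Z) := by
  have memLp_two {W : Ω → H} (hW : MemLp W 4 P) : MemLp W 2 P := hW.mono_exponent (by norm_num)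
  rw [scalarCov_hsRankOne_eq hY hZ hY' hZ' real_Z real_Z']
  refine (enorm_add_le _ _).trans (add_le_add ((enorm_add_le _ _).trans (add_le_add_right ?_ _))
    (enorm_hsInner_le_traceNorm_mul e _ _))
  rw [enorm_mul]
  exact mul_le_mul' (enorm_integral_inner_le_traceNorm e (memLp_two hY) (memLp_two hY'))
    (enorm_integral_inner_le_traceNorm e (memLp_two hZ') (memLp_two hZ))

end Cumulants

/-! ### Bias and variance of the estimator -/

section Fields

variable {H : Type*} [NormedAddCommGroup H] [InnerProductSpace ℂ H]
variable {ι : Type*} {e : HilbertBasis ι ℂ H}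
variable {Ω : Type*} [MeasurableSpace Ω] {P : Measure Ω} {d : ℕ} {X : (Fin d → ℤ) → Ω → H}

theorem IsSecondOrderStationary.covOp_eq_autoCov (hX : IsSecondOrderStationary e P X)
    (t s : Fin d → ℤ) : covOp P (X t) (X s) = autoCov P X (t - s) := by
  simpa [autoCov] using hX.cov_shift (t - s) 0 s

variable [CompleteSpace H]

theorem IsRegularField.sum_enorm_cum4_le (hX : IsRegularField e P X) (G : Finset (Fin d → ℤ))
    (t' s' : Fin d → ℤ) :
    ∑ p ∈ G ×ˢ G, ‖cum4 e P (X p.1) (X p.2) (X t') (X s')‖ₑ ≤ cumulantSum e P X := by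
  set φ := fun u v => ‖cum4 e P (X u) (X v) (X (t' - s')) (X 0)‖ₑ
  have shift (u v : Fin d → ℤ) :
      ‖cum4 e P (X u) (X v) (X t') (X s')‖ₑ = φ (u - s') (v - s') := by
    simpa using congrArg enorm (hX.cum_shift (u - s') (v - s') (t' - s') 0 s')
  calc ∑ p ∈ G ×ˢ G, ‖cum4 e P (X p.1) (X p.2) (X t') (X s')‖ₑ
      ≤ ∑' p : (Fin d → ℤ) × (Fin d → ℤ), φ (p.1 - s') (p.2 - s') := by
        simp only [shift]
        exact ENNReal.sum_le_tsum _
    _ = ∑' u, ∑' v, φ u v :=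
        (((Equiv.subRight s').prodCongr (Equiv.subRight s')).tsum_eq fun p => φ p.1 p.2).trans
          ENNReal.tsum_prod
    _ ≤ cumulantSum e P X :=
        le_iSup (fun w => ∑' u, ∑' v, ‖cum4 e P (X u) (X v) (X w) (X 0)‖ₑ) (t' - s')

theorem sum_product_mul_le_tsum_mul_tsum {α : Type*} (f g : α → ℝ≥0∞) (G : Finset α) :
    ∑ p ∈ G ×ˢ G, f p.1 * g p.2 ≤ (∑' a, f a) * ∑' a, g a := by
  rw [Finset.sum_product, ← Finset.sum_mul_sum]
  exact mul_le_mul' (ENNReal.sum_le_tsum G) (ENNReal.sum_le_tsum G)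

theorem IsRegularField.sum_enorm_scalarCov_le [TopologicalSpace.SeparableSpace H]
    [IsProbabilityMeasure P] (hX : IsRegularField e P X) (G : Finset (Fin d → ℤ))
    (t' s' : Fin d → ℤ) :
    ∑ p ∈ G ×ˢ G, ‖scalarCov P (fun ω => hsRankOne e (X p.1 ω) (X p.2 ω))
        (fun ω => hsRankOne e (X t' ω) (X s' ω))‖ₑ
      ≤ cumulantSum e P X + 2 * (∑' k, traceNorm e (autoCov P X k)) ^ 2 := by
  set τ := fun k => traceNorm e (autoCov P X k)
  have reflect (a : Fin d → ℤ) : ∑' k, τ (a - k) = ∑' k, τ k := (Equiv.subLeft a).tsum_eq τ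
  have translate (a : Fin d → ℤ) : ∑' k, τ (k - a) = ∑' k, τ k := (Equiv.subRight a).tsum_eq τ
  calc ∑ p ∈ G ×ˢ G, ‖scalarCov P (fun ω => hsRankOne e (X p.1 ω) (X p.2 ω))
        (fun ω => hsRankOne e (X t' ω) (X s' ω))‖ₑ
      ≤ ∑ p ∈ G ×ˢ G, (‖cum4 e P (X p.1) (X p.2) (X t') (X s')‖ₑ
          + τ (t' - p.1) * τ (p.2 - s') + τ (p.1 - s') * τ (t' - p.2)) := by
        refine Finset.sum_le_sum fun p _ => ?_
        simp only [τ, ← hX.stationary.covOp_eq_autoCov]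
        exact enorm_scalarCov_hsRankOne_le (hX.memLp_four _) (hX.memLp_four _) (hX.memLp_four _)
          (hX.memLp_four _) (hX.real _) (hX.real _)
    _ ≤ cumulantSum e P X + (∑' k, τ (t' - k)) * (∑' k, τ (k - s'))
          + (∑' k, τ (k - s')) * ∑' k, τ (t' - k) := by
        rw [Finset.sum_add_distrib, Finset.sum_add_distrib]
        gcongr
        · exact hX.sum_enorm_cum4_le G t' s'
        · exact sum_product_mul_le_tsum_mul_tsum (fun k => τ (t' - k)) (fun k => τ (k - s')) G
        · exact sum_product_mul_le_tsum_mul_tsum (fun k => τ (k - s')) (fun k => τ (t' - k)) G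
    _ = cumulantSum e P X + 2 * (∑' k, τ k) ^ 2 := by
        rw [reflect, translate]
        ring

end Fields

section EstimatorMoments

open InnerProductSpace (rankOne)

variable {H : Type*} [NormedAddCommGroup H] [InnerProductSpace ℂ H]
variable {Ω : Type*} {d : ℕ} {X : (Fin d → ℤ) → Ω → H}
variable {K : EuclideanSpace ℝ (Fin d) → ℝ} {N : Fin d → ℕ} {Δ : ℝ}

/-- The coefficient of `X(t) ⊗ X(s)`, `t - s = h`, in the lag-window estimator at frequency `θ`. -/
def lagWeight (K : EuclideanSpace ℝ (Fin d) → ℝ) (N : Fin d → ℕ) (Δ : ℝ) (θ : Fin d → ℝ)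
    (h : Fin d → ℤ) : ℂ :=
  (((2 * Real.pi) ^ d : ℝ) : ℂ)⁻¹ *
    (character h θ * ((K (Δ⁻¹ • latticePt h) / overlap N h : ℝ) : ℂ))

theorem enorm_lagWeight_sq_le (θ : Fin d → ℝ) (h : Fin d → ℤ) :
    ‖lagWeight K N Δ θ h‖ₑ ^ 2 ≤ ENNReal.ofReal ((K (Δ⁻¹ • latticePt h) / overlap N h) ^ 2) := by
  rw [lagWeight, enorm_mul, enorm_mul, ← ofReal_norm (character h θ), norm_character,
    ENNReal.ofReal_one, one_mul, ← ofReal_norm (Complex.ofReal _), Complex.norm_real,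
    Real.norm_eq_abs, ← sq_abs (K _ / _), ENNReal.ofReal_pow (abs_nonneg _)]
  gcongr
  exact mul_le_of_le_one_left' (enorm_inv_two_pi_pow_le_one d)

theorem sum_enorm_lagWeight_sq_le (θ : Fin d → ℝ) :
    ∑ p ∈ grid N ×ˢ grid N, ‖lagWeight K N Δ θ (p.1 - p.2)‖ₑ ^ 2
      ≤ ENNReal.ofReal (∑ h ∈ grid N - grid N, K (Δ⁻¹ • latticePt h) ^ 2 / overlap N h) := by
  refine (Finset.sum_le_sum fun p _ => enorm_lagWeight_sq_le θ (p.1 - p.2)).trans_eq ?_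
  rw [← ENNReal.ofReal_sum_of_nonneg fun p _ => sq_nonneg _, Finset.sum_product,
    sum_grid_sub N fun h => (K (Δ⁻¹ • latticePt h) / overlap N h) ^ 2]
  congr 1
  refine Finset.sum_congr rfl fun h hh => ?_
  rw [smul_eq_mul, div_pow, sq (overlap N h), mul_div_assoc',
    mul_div_mul_left _ _ (overlap_pos hh).ne']

theorem estimator_eq_sum (θ : Fin d → ℝ) (ω : Ω) :
    estimator K N Δ X θ ω = ∑ p ∈ grid N ×ˢ grid N,
      lagWeight K N Δ θ (p.1 - p.2) • rankOne ℂ (X p.1 ω) (X p.2 ω) := by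
  simp only [estimator, lagWeight, Finset.smul_sum, smul_smul, Finset.sum_product]

variable [MeasurableSpace Ω] {P : Measure Ω}

theorem integral_estimator_eq_sum (hX : ∀ t, MemLp (X t) 2 P) (θ : Fin d → ℝ) :
    ∫ ω, estimator K N Δ X θ ω ∂P = ∑ p ∈ grid N ×ˢ grid N,
      lagWeight K N Δ θ (p.1 - p.2) • covOp P (X p.1) (X p.2) := by
  simp only [estimator_eq_sum]
  rw [integral_finsetSum _ fun p _ => (integrable_rankOne (hX p.1) (hX p.2)).fun_smul _]
  simp only [integral_smul, covOp]

variable {ι : Type*} {e : HilbertBasis ι ℂ H}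

theorem integral_estimator_eq_fourierSeries (hX : IsSecondOrderStationary e P X) (hK : IsKernel K)
    (hΔ : 0 < Δ)
    (hsupp : ∀ k : Fin d → ℤ, latticePt k ∈ Δ • kernelSupport K → k ∈ grid N - grid N)
    (θ : Fin d → ℝ) :
    ∫ ω, estimator K N Δ X θ ω ∂P
      = fourierSeries (fun h => (K (Δ⁻¹ • latticePt h) : ℂ) • autoCov P X h) θ := by
  rw [integral_estimator_eq_sum hX.memLp_two, Finset.sum_product, fourierSeries,
    tsum_eq_sum (s := grid N - grid N) fun h hh => by
      rw [kernel_eq_zero_of_notMem_lags hsupp hK hΔ hh, Complex.ofReal_zero, zero_smul, smul_zero],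
    Finset.smul_sum]
  simp only [hX.covOp_eq_autoCov]
  rw [sum_grid_sub N fun h => lagWeight K N Δ θ h • autoCov P X h]
  refine Finset.sum_congr rfl fun h hh => ?_
  have overlap_ne_zero : (overlap N h : ℂ) ≠ 0 := by exact_mod_cast (overlap_pos hh).ne'
  rw [← Complex.coe_smul, smul_smul, smul_smul, smul_smul, lagWeight]
  congr 1
  push_cast
  field_simp

theorem summable_norm_of_tsum_traceNorm_lt_top [CompleteSpace H] {κ : Type*} {C : κ → H →L[ℂ] H}
    (hC : ∑' k, traceNorm e (C k) < ∞) : Summable fun k => ‖C k‖ := by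
  have tsum_enorm_ne_top : ∑' k, ‖C k‖ₑ ≠ ∞ := ne_top_of_le_ne_top hC.ne <|
    ENNReal.tsum_le_tsum fun k => (enorm_le_hsNorm e (C k)).trans (hsNorm_le_traceNorm e (C k))
  simpa only [toReal_enorm] using ENNReal.summable_toReal tsum_enorm_ne_top

theorem tsum_traceNorm_mul_le_of_mem_powerLawClass [CompleteSpace H] {C : (Fin d → ℤ) → H →L[ℂ] H}
    {β L : ℝ} (hC : ∑' k, traceNorm e (C k) < ∞) (hf : fourierSeries C ∈ powerLawClass e d β L) :
    ∑' k, traceNorm e (C k) * ENNReal.ofReal (1 + ‖latticePt k‖ ^ β) ≤ ENNReal.ofReal L := by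
  obtain ⟨C', series_eq, decay⟩ := hf
  have hC' : ∑' k, traceNorm e (C' k) < ∞ := by
    refine (ENNReal.tsum_le_tsum fun k => ?_).trans_lt (decay.trans_lt ENNReal.ofReal_lt_top)
    exact le_mul_of_one_le_right' (ENNReal.one_le_ofReal.2 (le_add_of_nonneg_right (by positivity)))
  rwa [(fourierSeries_inj (summable_norm_of_tsum_traceNorm_lt_top hC)
    (summable_norm_of_tsum_traceNorm_lt_top hC')).1 series_eq]

variable {β L : ℝ}

theorem enorm_kernel_sub_one_le (hΔ : 0 < Δ) {c : ℝ} (hc : ∀ u, |K u - 1| ≤ c * ‖u‖ ^ β)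
    (h : Fin d → ℤ) : ‖(K (Δ⁻¹ • latticePt h) : ℂ) - 1‖ₑ
      ≤ ENNReal.ofReal (c * Δ ^ (-β)) * ENNReal.ofReal (1 + ‖latticePt h‖ ^ β) := by
  rw [← Complex.ofReal_one, ← Complex.ofReal_sub, ← ofReal_norm, Complex.norm_real,
    Real.norm_eq_abs]
  calc ENNReal.ofReal |K (Δ⁻¹ • latticePt h) - 1|
      ≤ ENNReal.ofReal (c * Δ ^ (-β) * ‖latticePt h‖ ^ β) := by
        refine ENNReal.ofReal_le_ofReal ((hc _).trans_eq ?_)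
        rw [norm_smul, Real.norm_of_nonneg (inv_nonneg.2 hΔ.le),
          Real.mul_rpow (inv_nonneg.2 hΔ.le) (norm_nonneg _), Real.inv_rpow hΔ.le,
          ← Real.rpow_neg hΔ.le, mul_assoc]
    _ = ENNReal.ofReal (c * Δ ^ (-β)) * ENNReal.ofReal (‖latticePt h‖ ^ β) :=
        ENNReal.ofReal_mul' (by positivity)
    _ ≤ ENNReal.ofReal (c * Δ ^ (-β)) * ENNReal.ofReal (1 + ‖latticePt h‖ ^ β) := by
        gcongr
        exact le_add_of_nonneg_left zero_le_one

variable [CompleteSpace H]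

theorem hsNorm_integral_estimator_sub_spectralDensity_le (hX : IsSecondOrderStationary e P X)
    (summable_cov : ∑' k, traceNorm e (autoCov P X k) < ∞)
    (hf : spectralDensity P X ∈ powerLawClass e d β L) (hK : IsKernel K) (hΔ : 0 < Δ)
    (hsupp : ∀ k : Fin d → ℤ, latticePt k ∈ Δ • kernelSupport K → k ∈ grid N - grid N)
    {c : ℝ} (hc : ∀ u, |K u - 1| ≤ c * ‖u‖ ^ β) (θ : Fin d → ℝ) :
    hsNorm e ((∫ ω, estimator K N Δ X θ ω ∂P) - spectralDensity P X θ)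
      ≤ ENNReal.ofReal (c * Δ ^ (-β)) * ENNReal.ofReal L := by
  set C := autoCov P X
  have summable_C := summable_norm_of_tsum_traceNorm_lt_top summable_cov
  have summable_K_smul : Summable fun h => ‖(K (Δ⁻¹ • latticePt h) : ℂ) • C h‖ := by
    refine summable_C.of_nonneg_of_le (fun _ => norm_nonneg _) fun h => ?_
    rw [norm_smul, Complex.norm_real, Real.norm_of_nonneg (hK.nonneg _)]
    exact mul_le_of_le_one_left (norm_nonneg _) (hK.le_one _)
  rw [integral_estimator_eq_fourierSeries hX hK hΔ hsupp, spectralDensity,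
    ← fourierSeries_sub summable_K_smul summable_C]
  refine (hsNorm_fourierSeries_le e _ θ).trans ?_
  calc ∑' h, hsNorm e ((K (Δ⁻¹ • latticePt h) : ℂ) • C h - C h)
      ≤ ∑' h, ENNReal.ofReal (c * Δ ^ (-β)) *
          (traceNorm e (C h) * ENNReal.ofReal (1 + ‖latticePt h‖ ^ β)) := by
        refine ENNReal.tsum_le_tsum fun h => ?_
        have factor : (K (Δ⁻¹ • latticePt h) : ℂ) • C h - C h
            = ((K (Δ⁻¹ • latticePt h) : ℂ) - 1) • C h := by rw [sub_smul, one_smul]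
        rw [factor, hsNorm_smul, mul_left_comm, mul_comm]
        exact mul_le_mul' (hsNorm_le_traceNorm e _) (enorm_kernel_sub_one_le hΔ hc h)
    _ ≤ ENNReal.ofReal (c * Δ ^ (-β)) * ENNReal.ofReal L := by
        rw [ENNReal.tsum_mul_left]
        gcongr
        exact tsum_traceNorm_mul_le_of_mem_powerLawClass summable_cov hf

end EstimatorMoments

section MeanSquaredError

variable {H : Type*} [NormedAddCommGroup H] [InnerProductSpace ℂ H]
variable {Ω : Type*} [MeasurableSpace Ω] {P : Measure Ω} {d : ℕ} {X : (Fin d → ℤ) → Ω → H}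
variable {K : EuclideanSpace ℝ (Fin d) → ℝ} {N : Fin d → ℕ} {Δ : ℝ}
variable {ι : Type*} {e : HilbertBasis ι ℂ H}

theorem lintegral_hsNorm_sub_sq_le [IsProbabilityMeasure P] (F : Ω → H →L[ℂ] H) (A B : H →L[ℂ] H) :
    ∫⁻ ω, hsNorm e (F ω - B) ^ 2 ∂P
      ≤ 2 * (∫⁻ ω, hsNorm e (F ω - A) ^ 2 ∂P + hsNorm e (A - B) ^ 2) := by
  have pointwise (ω : Ω) :
      hsNorm e (F ω - B) ^ 2 ≤ 2 * (hsNorm e (F ω - A) ^ 2 + hsNorm e (A - B) ^ 2) := by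
    rw [← sub_add_sub_cancel (F ω) A B]
    refine (pow_le_pow_left' (hsNorm_add_le e _ _) 2).trans ?_
    rw [add_sq', mul_assoc, two_mul (_ + _)]
    gcongr
    exact two_mul_mul_le_sq_add_sq _ _
  calc ∫⁻ ω, hsNorm e (F ω - B) ^ 2 ∂P
      ≤ ∫⁻ ω, 2 * (hsNorm e (F ω - A) ^ 2 + hsNorm e (A - B) ^ 2) ∂P := lintegral_mono pointwise
    _ = 2 * (∫⁻ ω, hsNorm e (F ω - A) ^ 2 ∂P + hsNorm e (A - B) ^ 2) := by
        rw [lintegral_const_mul' _ _ ENNReal.ofNat_ne_top, lintegral_add_right _ measurable_const,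
          lintegral_const, measure_univ, mul_one]

variable [CompleteSpace H]

theorem representsHS_estimator_sub_integral (hX : ∀ t, MemLp (X t) 2 P) (θ : Fin d → ℝ) (ω : Ω) :
    RepresentsHS e (estimator K N Δ X θ ω - ∫ ω', estimator K N Δ X θ ω' ∂P)
      (∑ p ∈ grid N ×ˢ grid N, lagWeight K N Δ θ (p.1 - p.2) •
        (hsRankOne e (X p.1 ω) (X p.2 ω) - ∫ ω', hsRankOne e (X p.1 ω') (X p.2 ω') ∂P)) := by
  rw [integral_estimator_eq_sum hX, estimator_eq_sum, ← Finset.sum_sub_distrib]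
  simp only [← smul_sub]
  exact .sum fun p _ => ((representsHS_hsRankOne e _ _).sub
    (representsHS_covOp e (hX p.1) (hX p.2))).smul _

variable [TopologicalSpace.SeparableSpace H] [IsProbabilityMeasure P]

theorem lintegral_hsNorm_estimator_sub_integral_sq_le (hX : IsRegularField e P X)
    (θ : Fin d → ℝ) :
    ∫⁻ ω, hsNorm e (estimator K N Δ X θ ω - ∫ ω', estimator K N Δ X θ ω' ∂P) ^ 2 ∂P
      ≤ (cumulantSum e P X + 2 * (∑' k, traceNorm e (autoCov P X k)) ^ 2) *
        ENNReal.ofReal (∑ h ∈ grid N - grid N, K (Δ⁻¹ • latticePt h) ^ 2 / overlap N h) := by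
  have variance := lintegral_enorm_sq_sum_smul_sub_le (P := P) (grid N ×ˢ grid N)
    (fun p => lagWeight K N Δ θ (p.1 - p.2))
    (fun p => memLp_two_hsRankOne e (hX.memLp_four p.1) (hX.memLp_four p.2))
    fun p _ => hX.sum_enorm_scalarCov_le (grid N) p.1 p.2
  calc _ = _ := lintegral_congr fun ω => by
          rw [(representsHS_estimator_sub_integral hX.stationary.memLp_two θ ω).hsNorm_eq]
          exact congrArg (‖·‖ₑ ^ 2) (Finset.sum_congr rfl fun p _ => rfl)
    _ ≤ _ := variance
    _ ≤ _ := by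
      gcongr
      exact sum_enorm_lagWeight_sq_le θ

variable {β L : ℝ} {M : ℝ≥0}

theorem lintegral_hsNorm_estimator_sub_spectralDensity_sq_le (hX : IsRegularField e P X)
    (hM : cumulantSum e P X ≤ M) (hf : spectralDensity P X ∈ powerLawClass e d β L)
    (hK : IsKernel K) (hΔ : 0 < Δ)
    (hsupp : ∀ k : Fin d → ℤ, latticePt k ∈ Δ • kernelSupport K → k ∈ grid N - grid N)
    {c : ℝ} (hc : ∀ u, |K u - 1| ≤ c * ‖u‖ ^ β) (θ : Fin d → ℝ) :
    ∫⁻ ω, hsNorm e (estimator K N Δ X θ ω - spectralDensity P X θ) ^ 2 ∂P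
      ≤ 2 * ((M + 2 * ENNReal.ofReal L ^ 2) *
          ENNReal.ofReal (∑ h ∈ grid N - grid N, K (Δ⁻¹ • latticePt h) ^ 2 / overlap N h)
        + (ENNReal.ofReal (c * Δ ^ (-β)) * ENNReal.ofReal L) ^ 2) := by
  have tsum_traceNorm_le : ∑' k, traceNorm e (autoCov P X k) ≤ ENNReal.ofReal L :=
    (ENNReal.tsum_le_tsum fun k => le_mul_of_one_le_right' <|
        ENNReal.one_le_ofReal.2 (le_add_of_nonneg_right (by positivity))).trans
      (tsum_traceNorm_mul_le_of_mem_powerLawClass hX.summable_cov hf)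
  refine (lintegral_hsNorm_sub_sq_le _ (∫ ω, estimator K N Δ X θ ω ∂P) _).trans ?_
  gcongr
  · refine (lintegral_hsNorm_estimator_sub_integral_sq_le hX θ).trans ?_
    gcongr
  · exact hsNorm_integral_estimator_sub_spectralDensity_le hX.stationary hX.summable_cov hf hK hΔ
      hsupp hc θ

theorem rootMeanSquaredError_estimator_le (hX : IsRegularField e P X)
    (hM : cumulantSum e P X ≤ M) (hf : spectralDensity P X ∈ powerLawClass e d β L)
    (hK : IsKernel K) (hΔ : 0 < Δ)
    (hsupp : ∀ k : Fin d → ℤ, latticePt k ∈ Δ • kernelSupport K → k ∈ grid N - grid N)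
    {c C ρ : ℝ} (hc0 : 0 ≤ c) (hc : ∀ u, |K u - 1| ≤ c * ‖u‖ ^ β) (hρ : Δ ^ (-β) = ρ)
    (hC0 : 0 ≤ C)
    (hC : ∑ h ∈ grid N - grid N, K (Δ⁻¹ • latticePt h) ^ 2 / overlap N h ≤ C * ρ ^ 2)
    (θ : Fin d → ℝ) :
    (∫⁻ ω, hsNorm e (estimator K N Δ X θ ω - spectralDensity P X θ) ^ 2 ∂P) ^ (1 / 2 : ℝ)
      ≤ ENNReal.ofReal (√(2 * ((M + 2 * L.toNNReal ^ 2) * C + (c * L.toNNReal) ^ 2)) * ρ) := by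
  have ρ_nonneg : 0 ≤ ρ := hρ ▸ Real.rpow_nonneg hΔ.le _
  have constant_nonneg : 0 ≤ 2 * ((M + 2 * L.toNNReal ^ 2) * C + (c * L.toNNReal) ^ 2) := by
    positivity
  rw [one_div, ENNReal.rpow_inv_le_iff two_pos, ENNReal.rpow_two]
  calc ∫⁻ ω, hsNorm e (estimator K N Δ X θ ω - spectralDensity P X θ) ^ 2 ∂P
      ≤ 2 * ((M + 2 * ENNReal.ofReal L ^ 2) * ENNReal.ofReal (C * ρ ^ 2)
          + (ENNReal.ofReal (c * ρ) * ENNReal.ofReal L) ^ 2) := by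
        refine (lintegral_hsNorm_estimator_sub_spectralDensity_sq_le hX hM hf hK hΔ hsupp hc
          θ).trans ?_
        rw [hρ]
        gcongr
    _ = ENNReal.ofReal (√(2 * ((M + 2 * L.toNNReal ^ 2) * C + (c * L.toNNReal) ^ 2)) * ρ) ^ 2 := by
        rw [← ENNReal.ofReal_pow (mul_nonneg (Real.sqrt_nonneg _) ρ_nonneg), mul_pow √_,
          Real.sq_sqrt constant_nonneg]
        lift c to ℝ≥0 using hc0
        lift C to ℝ≥0 using hC0
        lift ρ to ℝ≥0 using ρ_nonneg
        rw [ENNReal.ofReal.eq_1 L]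
        norm_cast
        simp only [ENNReal.ofReal_coe_nnreal]
        push_cast
        ring

end MeanSquaredError

section Rates

variable {d : ℕ} {β n : ℝ}

theorem bandwidth_rpow_neg (hn : 0 ≤ n) :
    (n ^ (1 / (2 * β + d))) ^ (-β) = n ^ (-(β / (2 * β + d))) := by
  rw [← Real.rpow_mul hn]
  ring_nf

theorem bandwidth_pow_div (hn : 0 < n) (hβ : 2 * β + d ≠ 0) :
    (n ^ (1 / (2 * β + d))) ^ d / n = (n ^ (-(β / (2 * β + d)))) ^ 2 := by
  rw [← Real.rpow_natCast, ← Real.rpow_natCast, ← Real.rpow_mul hn.le, ← Real.rpow_mul hn.le,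
    ← Real.rpow_sub_one hn.ne']
  congr 1
  field_simp
  push_cast
  ring

theorem exists_sum_sq_div_overlap_le_of_bandwidth (hd : 1 ≤ d) {K : EuclideanSpace ℝ (Fin d) → ℝ}
    {r : ℕ} (hK : IsKernel K) (hKr : IsFlatToOrder K r) (hβ : 0 ≤ β) :
    ∃ C, 0 ≤ C ∧ ∀ (N : Fin d → ℕ) (Δ : ℝ), 0 < Δ →
      (∀ k : Fin d → ℤ, latticePt k ∈ Δ • kernelSupport K → k ∈ grid N - grid N) →
      Δ = ((grid N).card : ℝ) ^ (1 / (2 * β + d)) →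
      ∑ h ∈ grid N - grid N, K (Δ⁻¹ • latticePt h) ^ 2 / overlap N h
        ≤ C * (((grid N).card : ℝ) ^ (-(β / (2 * β + d)))) ^ 2 := by
  have exponent_pos : 0 < 2 * β + d := by
    have : (1 : ℝ) ≤ d := by exact_mod_cast hd
    linarith
  obtain ⟨C, hC0, hC⟩ := exists_sum_sq_div_overlap_le hd hK hKr
  refine ⟨C, hC0, fun N Δ hΔ hsupp hbandwidth => ?_⟩
  have card_ne_zero : (grid N).card ≠ 0 := fun h => by
    rw [hbandwidth, h, Nat.cast_zero, Real.zero_rpow (one_div_pos.2 exponent_pos).ne'] at hΔ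
    exact hΔ.false
  have one_le_N (l : Fin d) : 1 ≤ N l := by
    rw [card_grid, Finset.prod_ne_zero_iff] at card_ne_zero
    exact Nat.one_le_iff_ne_zero.2 (card_ne_zero l (Finset.mem_univ l))
  have one_le_Δ : 1 ≤ Δ := hbandwidth ▸ Real.one_le_rpow
    (by exact_mod_cast Nat.one_le_iff_ne_zero.2 card_ne_zero) (one_div_pos.2 exponent_pos).le
  refine (hC N Δ one_le_Δ one_le_N hsupp).trans_eq ?_
  rw [← bandwidth_pow_div (by positivity) exponent_pos.ne', ← hbandwidth]

universe u v

theorem mainTheorem7_general {d : ℕ} (hd : 1 ≤ d)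
    {H : Type*} [NormedAddCommGroup H] [InnerProductSpace ℂ H] [CompleteSpace H]
    [TopologicalSpace.SeparableSpace H] {ι : Type*} (e : HilbertBasis ι ℂ H)
    {K : EuclideanSpace ℝ (Fin d) → ℝ} (hK : IsKernel K) {β : ℝ} (hβ : 0 ≤ β) (L : ℝ)
    {r : ℕ} (hr : β - 1 ≤ r) (hKr : IsFlatToOrder K r) :
    (∃ c : ℝ, ∀ (N : Fin d → ℕ) (Δ : ℝ), 0 < Δ →
      (∀ k : Fin d → ℤ, latticePt k ∈ Δ • kernelSupport K → k ∈ grid N - grid N) →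
      ∀ (Ω : Type u) [MeasurableSpace Ω] (P : Measure Ω) (X : (Fin d → ℤ) → Ω → H),
        IsSecondOrderStationary e P X → ∑' k, traceNorm e (autoCov P X k) < ∞ →
        spectralDensity P X ∈ powerLawClass e d β L → ∀ θ : Fin d → ℝ,
          hsNorm e ((∫ ω, estimator K N Δ X θ ω ∂P) - spectralDensity P X θ)
            ≤ ENNReal.ofReal (c * Δ ^ (-β))) ∧
    ∀ M : ℝ≥0, ∃ c : ℝ, ∀ (N : Fin d → ℕ) (Δ : ℝ), 0 < Δ →
      (∀ k : Fin d → ℤ, latticePt k ∈ Δ • kernelSupport K → k ∈ grid N - grid N) →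
      Δ = ((grid N).card : ℝ) ^ (1 / (2 * β + d)) →
      ∀ (Ω : Type v) [MeasurableSpace Ω] (P : Measure Ω) [IsProbabilityMeasure P]
        (X : (Fin d → ℤ) → Ω → H),
        IsRegularField e P X → cumulantSum e P X ≤ M →
        spectralDensity P X ∈ powerLawClass e d β L → ∀ θ : Fin d → ℝ,
          (∫⁻ ω, hsNorm e (estimator K N Δ X θ ω - spectralDensity P X θ) ^ 2 ∂P) ^ (1 / 2 : ℝ)
            ≤ ENNReal.ofReal (c * ((grid N).card : ℝ) ^ (-(β / (2 * β + d)))) := by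
  obtain ⟨c, hc0, hc⟩ := exists_abs_kernel_sub_one_le hK hKr hβ hr
  obtain ⟨C, hC0, hC⟩ := exists_sum_sq_div_overlap_le_of_bandwidth hd hK hKr hβ
  refine ⟨⟨c * L, fun N Δ hΔ hsupp Ω _ P X hX summable_cov hf θ => ?_⟩,
    fun M => ⟨√(2 * ((M + 2 * L.toNNReal ^ 2) * C + (c * L.toNNReal) ^ 2)),
      fun N Δ hΔ hsupp hbandwidth Ω _ P _ X hX hM hf θ => ?_⟩⟩
  · refine (hsNorm_integral_estimator_sub_spectralDensity_le hX summable_cov hf hK hΔ hsupp hc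
      θ).trans_eq ?_
    rw [← ENNReal.ofReal_mul (by positivity), mul_right_comm]
  · have rate : Δ ^ (-β) = ((grid N).card : ℝ) ^ (-(β / (2 * β + d))) :=
      hbandwidth ▸ bandwidth_rpow_neg (Nat.cast_nonneg _)
    exact rootMeanSquaredError_estimator_le hX hM hf hK hΔ hsupp hc0 hc rate hC0
      (hC N Δ hΔ hsupp hbandwidth) θ

end Rates

end SpectralDensity

end

theorem mainTheorem7
    {d : ℕ} (hd : 1 ≤ d)
    {H : Type*} [NormedAddCommGroup H] [InnerProductSpace ℂ H] [CompleteSpace H]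
    [TopologicalSpace.SeparableSpace H]
    {ι : Type*} (e : HilbertBasis ι ℂ H)
    (K : EuclideanSpace ℝ (Fin d) → ℝ) (hK : IsKernel K)
    (β L : ℝ) (hβ : 0 < β) (hL : 0 < L)
    (r : ℕ) (hr : max 0 (β - 1) < (r : ℝ)) (hKr : IsFlatToOrder K r)
    (N : ℕ → Fin d → ℕ) (hN : ∀ i, Tendsto (fun n => N n i) atTop atTop)
    (Δ : ℕ → ℝ) (hΔ : ∀ n, 0 < Δ n)
    (hsupp : ∀ n, ∀ k : Fin d → ℤ,
      latticePt k ∈ Δ n • kernelSupport K →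
        k ∈ grid (N n) - grid (N n))
    (hrate : Tendsto (fun n => Δ n ^ d / ((grid (N n)).card : ℝ)) atTop (𝓝 0)) :
    -- the bias
    (∃ c : ℝ, ∀ᶠ n in atTop,
      ∀ (Ω : Type*) [MeasurableSpace Ω] (P : Measure Ω) [IsProbabilityMeasure P]
        (X : (Fin d → ℤ) → Ω → H),
        IsRegularField e P X →
        spectralDensity P X ∈ powerLawClass e d β L →
        ∀ θ ∈ Set.Icc (fun _ : Fin d => -Real.pi) (fun _ => Real.pi),
          hsNorm e
              ((∫ ω, estimator K (N n) (Δ n) X θ ω ∂P)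
                - spectralDensity P X θ)
            ≤ ENNReal.ofReal (c * Δ n ^ (-β))) ∧
    -- the root mean squared error
    ((∀ n, Δ n = ((grid (N n)).card : ℝ) ^ (1 / (2 * β + d))) →
      ∀ M : ℝ≥0, ∃ c : ℝ, ∀ᶠ n in atTop,
        ∀ (Ω : Type*) [MeasurableSpace Ω] (P : Measure Ω) [IsProbabilityMeasure P]
          (X : (Fin d → ℤ) → Ω → H),
          IsRegularField e P X →
          cumulantSum e P X ≤ M →
          spectralDensity P X ∈ powerLawClass e d β L →
          ∀ θ ∈ Set.Icc (fun _ : Fin d => -Real.pi) (fun _ => Real.pi),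
            (∫⁻ ω, hsNorm e
                (estimator K (N n) (Δ n) X θ ω
                  - spectralDensity P X θ) ^ 2 ∂P) ^ (1 / 2 : ℝ)
              ≤ ENNReal.ofReal
                  (c * ((grid (N n)).card : ℝ) ^ (-(β / (2 * β + d))))) := by
  have hr' : β - 1 ≤ r := (le_max_right _ _).trans hr.le
  obtain ⟨⟨c, bias⟩, rmse⟩ := mainTheorem7_general hd e hK hβ.le L hr' hKr
  refine ⟨⟨c, .of_forall fun n Ω _ P _ X hX hf θ _ => bias (N n) (Δ n) (hΔ n) (hsupp n) Ω P X
    hX.stationary hX.summable_cov hf θ⟩, fun hbandwidth M => ?_⟩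
  obtain ⟨c, rmse⟩ := rmse M
  exact ⟨c, .of_forall fun n Ω _ P _ X hX hM hf θ _ =>
    rmse (N n) (Δ n) (hΔ n) (hsupp n) (hbandwidth n) Ω P X hX hM hf θ⟩
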